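/- Let $\mathbb K$ be an algebraically closed field of characteristic zero, $M=\mathbb Z^n$, $N=\mathbb Z^n$ its dual lattice with pairing $\langle\cdot,\cdot\rangle$, and let $P\subset M$ be a finitely generated submonoid that generates $M$ as a group. Let $X$ be the (not necessarily normal) affine toric variety with weight monoid $P$, i.e. $\mathbb K[X]=\bigoplus_{m\in P}\mathbb K\chi^m\subset\mathbb K[T]=\bigoplus_{m\in M}\mathbb K\chi^m$ with the natural action of the torus $T=(\mathbb K^\times)^n$. Let $\sigma^\vee=\mathbb Q_{\ge 0}P\subset M_{\mathbb Q}$ and let $\sigma=\{v\in N_{\mathbb Q}\mid \langle w,v\rangle\ge 0 \text{ for all } w\in\sigma^\vee\}$. Let $\rho$ be an extremal ray (one-dimensional face) of $\sigma$, let $n_\rho\in N$ be the primitive integer vector on $\rho$, and put $\widehat\rho=\rho^\perp\cap\sigma^\vee$. Let $O_\rho$ be the corresponding $T$-orbit of codimension one, i.e. the $T$-orbit that is open in the zero set of the ideal $\bigoplus_{m\in P\setminus\widehat\rho}\mathbb K\chi^m$ of $\mathbb K[X]$. Then the following conditions are equivalent: 1) the face $\widehat\rho$ of $\sigma^\vee$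 is almost saturated, i.e. there is $p\in P\cap\widehat\rho$ with $(p+\sigma^\vee)\cap M\subset P$; 2) there is a Demazure root $e\in\mathscr R_\rho$, i.e. $e\in M$ with $\langle e,n_\rho\rangle=-1$ and $\langle e,n_\xi\rangle\ge 0$ for every extremal ray $\xi\ne\rho$ of $\sigma$ (with primitive integer vector $n_\xi$), such that the formula $\delta_e(\chi^m)=\langle m,n_\rho\rangle\chi^{m+e}$, $m\in P$, gives a well-defined locally nilpotent derivation $\delta_e$ of $\mathbb K[X]$; 3) the orbit $O_\rho$ consists of smooth points of $X$. -/

import Mathlib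

namespace ToricLND

open scoped Matrix

noncomputable section

/-!
Conventions. The character lattice `M` of the torus `T = (Kˣ)ⁿ` and the lattice `N` of its
one-parameter subgroups are both `Fin n → ℤ`, paired by the dot product; `M_ℚ` and `N_ℚ` are
`Fin n → ℚ`. The variety `X` is given by its weight monoid `P ⊆ M`.
-/

/-- The inclusion of the lattice `ℤⁿ` in `ℚⁿ`. -/
def latticeVec {n : ℕ} (m : Fin n → ℤ) : Fin n → ℚ := fun i => (m i : ℚ)

/-! ### Cones -/

/-- The cone `σ^∨ = ℚ_{≥0} P ⊆ M_ℚ` generated by the monoid `P`. -/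
def weightCone {n : ℕ} (P : AddSubmonoid (Fin n → ℤ)) : PointedCone ℚ (Fin n → ℚ) :=
  PointedCone.hull ℚ (latticeVec '' (P : Set (Fin n → ℤ)))

/-- The cone `σ = {v ∈ N_ℚ | ⟨w, v⟩ ≥ 0 for all w ∈ σ^∨}`. -/
def fanCone {n : ℕ} (P : AddSubmonoid (Fin n → ℤ)) : PointedCone ℚ (Fin n → ℚ) :=
  PointedCone.dual (dotProductBilin ℚ ℚ) (weightCone P : Set (Fin n → ℚ))

/-- An extremal ray of a cone: a one-dimensional face. -/
def IsExtremalRay {n : ℕ} (ρ σ : PointedCone ℚ (Fin n → ℚ)) : Prop :=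
  ρ.IsFaceOf σ ∧ Module.finrank ℚ (Submodule.span ℚ (ρ : Set (Fin n → ℚ))) = 1

/-- `v` is the primitive integer vector on the ray `ρ`: a nonzero lattice vector on `ρ` that is
not a proper multiple of another lattice vector. -/
def IsPrimitiveVectorOn {n : ℕ} (ρ : PointedCone ℚ (Fin n → ℚ)) (v : Fin n → ℤ) : Prop :=
  latticeVec v ∈ ρ ∧ v ≠ 0 ∧ ∀ (k : ℤ) (u : Fin n → ℤ), v = k • u → IsUnit k

/-- The face `ρ̂ = ρ^⊥ ∩ σ^∨` of `σ^∨`. -/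
def dualFace {n : ℕ} (P : AddSubmonoid (Fin n → ℤ)) (ρ : PointedCone ℚ (Fin n → ℚ)) :
    PointedCone ℚ (Fin n → ℚ) where
  carrier := {w | w ∈ weightCone P ∧ ∀ v ∈ ρ, w ⬝ᵥ v = 0}
  zero_mem' := ⟨zero_mem _, fun v _ => zero_dotProduct v⟩
  add_mem' := fun {a b} ha hb =>
    ⟨add_mem ha.1 hb.1, fun v hv => by rw [add_dotProduct, ha.2 v hv, hb.2 v hv, add_zero]⟩
  smul_mem' := fun c a ha =>
    ⟨Submodule.smul_mem _ c ha.1, fun v hv => by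
      rw [smul_dotProduct, ha.2 v hv, smul_zero]⟩

/-! ### Almost saturated faces -/

/-- `p ∈ P` is a saturation point of `P` if `(p + σ^∨) ∩ M ⊆ P`. -/
def IsSaturationPoint {n : ℕ} (P : AddSubmonoid (Fin n → ℤ)) (p : Fin n → ℤ) : Prop :=
  p ∈ P ∧ ∀ m : Fin n → ℤ, (∃ c ∈ weightCone P, latticeVec m = latticeVec p + c) → m ∈ P

/-- A face `τ` of `σ^∨` is almost saturated if it contains a saturation point of `P`. -/
def IsAlmostSaturated {n : ℕ} (P : AddSubmonoid (Fin n → ℤ))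
    (τ : PointedCone ℚ (Fin n → ℚ)) : Prop :=
  ∃ p : Fin n → ℤ, IsSaturationPoint P p ∧ latticeVec p ∈ τ

/-! ### The coordinate algebra and Demazure roots -/

/-- The algebra of regular functions `K[X] = ⨁_{m ∈ P} K χ^m`, a subalgebra of
`K[T] = ⨁_{m ∈ M} K χ^m`. -/
def coordRing (K : Type*) [Field K] {n : ℕ} (P : AddSubmonoid (Fin n → ℤ)) :
    Subalgebra K (AddMonoidAlgebra K (Fin n → ℤ)) :=
  (AddMonoidAlgebra.supported K K (P : Set (Fin n → ℤ))).toSubalgebra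
    (by
      rw [AddMonoidAlgebra.supported_eq_span_single]
      exact Submodule.subset_span ⟨0, P.zero_mem, rfl⟩)
    (by
      intro a b ha hb
      classical
      rw [AddMonoidAlgebra.mem_supported] at ha hb ⊢
      intro m hm
      obtain ⟨x, hx, y, hy, rfl⟩ := Finset.mem_add.mp (AddMonoidAlgebra.support_coeff_mul_subset a b hm)
      exact P.add_mem (ha hx) (hb hy))

/-- The character `χ^m`, `m ∈ P`, as an element of `K[X]`. -/
def chi (K : Type*) [Field K] {n : ℕ} (P : AddSubmonoid (Fin n → ℤ)) (m : P) : coordRing K P :=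
  ⟨AddMonoidAlgebra.single (m : Fin n → ℤ) 1, by
    change _ ∈ AddMonoidAlgebra.supported K K (P : Set (Fin n → ℤ))
    rw [AddMonoidAlgebra.supported_eq_span_single]
    exact Submodule.subset_span ⟨m, m.2, rfl⟩⟩

/-- The set `R_ρ` of Demazure roots of `σ` corresponding to the extremal ray `ρ`: the `e ∈ M`
with `⟨e, n_ρ⟩ = -1` and `⟨e, n_ξ⟩ ≥ 0` for every other extremal ray `ξ` of `σ`, where `n_ρ`,
`n_ξ` are the primitive integer vectors on the rays. -/
def demazureRoots {n : ℕ} (P : AddSubmonoid (Fin n → ℤ)) (ρ : PointedCone ℚ (Fin n → ℚ)) :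
    Set (Fin n → ℤ) :=
  {e | (∃ v, IsPrimitiveVectorOn ρ v ∧ e ⬝ᵥ v = -1) ∧
    ∀ ξ, IsExtremalRay ξ (fanCone P) → ξ ≠ ρ → ∀ v, IsPrimitiveVectorOn ξ v → 0 ≤ e ⬝ᵥ v}

/-- The formula `χ^m ↦ ⟨m, n_ρ⟩ χ^{m+e}` (`m ∈ P`) gives a well-defined locally nilpotent
derivation `δ_e` of `K[X]`: there is a locally nilpotent `K`-derivation `δ` of `K[X]` with
`δ(χ^m) = ⟨m, n_ρ⟩ χ^{m+e}` in `K[T]` for every `m ∈ P`. Here `v` is the vector `n_ρ`. -/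
def DemazureLNDWellDefined (K : Type*) [Field K] {n : ℕ} (P : AddSubmonoid (Fin n → ℤ))
    (v e : Fin n → ℤ) : Prop :=
  ∃ δ : Derivation K (coordRing K P) (coordRing K P),
    (∀ m : P, (δ (chi K P m) : AddMonoidAlgebra K (Fin n → ℤ)) =
      AddMonoidAlgebra.single ((m : Fin n → ℤ) + e) ((((m : Fin n → ℤ) ⬝ᵥ v : ℤ)) : K)) ∧
    ∀ f : coordRing K P, ∃ k : ℕ, (δ : coordRing K P → coordRing K P)^[k] f = 0

/-! ### Points, orbits, smoothness -/

/-- The points of `X` (over the algebraically closed field `K`). -/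
abbrev Point (K : Type*) [Field K] {n : ℕ} (P : AddSubmonoid (Fin n → ℤ)) : Type _ :=
  coordRing K P →ₐ[K] K

/-- The value `χ^m(t)` of a character at a point `t` of the torus `T = (Kˣ)ⁿ`. -/
def charEval {K : Type*} [Field K] {n : ℕ} (m : Fin n → ℤ) (t : Fin n → Kˣ) : Kˣ :=
  ∏ i, t i ^ m i

/-- The orbit `T · x`: the point `t · x` is determined by `χ^m(t · x) = χ^m(t) χ^m(x)` for all
`m ∈ P`. -/
def torusOrbit {K : Type*} [Field K] {n : ℕ} {P : AddSubmonoid (Fin n → ℤ)} (x : Point K P) :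
    Set (Point K P) :=
  {y | ∃ t : Fin n → Kˣ, ∀ m : P,
    y (chi K P m) = (charEval (m : Fin n → ℤ) t : K) * x (chi K P m)}

/-- The set of common zeros in `X` of a set of regular functions. These are the Zariski closed
subsets of `X`. -/
def zeroSet {K : Type*} [Field K] {n : ℕ} {P : AddSubmonoid (Fin n → ℤ)}
    (S : Set (coordRing K P)) : Set (Point K P) :=
  {x | ∀ f ∈ S, x f = 0}

/-- The ideal `I_τ = ⨁_{m ∈ P \ τ} K χ^m` of a face `τ` of `σ^∨`. -/
def faceIdeal (K : Type*) [Field K] {n : ℕ} (P : AddSubmonoid (Fin n → ℤ))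
    (τ : PointedCone ℚ (Fin n → ℚ)) : Ideal (coordRing K P) :=
  Ideal.span {f | ∃ m : P, latticeVec (m : Fin n → ℤ) ∉ τ ∧ f = chi K P m}

/-- The `T`-orbit corresponding to a face `τ` of `σ^∨`: the orbit which is (Zariski) open in the
zero set of the ideal `I_τ`. -/
def faceOrbit (K : Type*) [Field K] {n : ℕ} (P : AddSubmonoid (Fin n → ℤ))
    (τ : PointedCone ℚ (Fin n → ℚ)) : Set (Point K P) :=
  {x | ∃ S : Set (coordRing K P), torusOrbit x = zeroSet (faceIdeal K P τ : Set _) \ zeroSet S}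

/-- `x` is a smooth point of `X`: `K[X]` is smooth over `K` at the maximal ideal of `x`. -/
def IsSmoothPoint {K : Type*} [Field K] {n : ℕ} {P : AddSubmonoid (Fin n → ℤ)}
    (x : Point K P) : Prop :=
  haveI : (RingHom.ker x).IsPrime := RingHom.ker_isPrime x
  Algebra.IsSmoothAt K (RingHom.ker x)

end

end ToricLND

namespace ToricLND

open scoped Matrix

noncomputable section

/-! ### Lattice points of the cones -/

/-! Write `v` for the primitive vector of the ray, `F` for `P ∩ v^⊥`, and call `⟨m, v⟩` the height
of `m`. Each of the three conditions is equivalent to one combinatorial condition,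
`IsLocallyHalfSpace`: inverting `F` turns `P` into the monoid of all lattice points of nonnegative
height. Convex geometry enters through `IsExtremalRay.isFacetNormal`: `F` spans `v^⊥` rationally.

Almost saturation: a saturation point on the facet absorbs the denominators coming from rational
spanning. Conversely, finite generation reduces the lattice points of the cone to a finite box
modulo `P`, and the sum of the corrections from `F` needed there is a saturation point.

Roots: `δ_e` is well defined exactly when `P` is stable under `m ↦ m + e` at positive height. Any
`e` of height `-1` can be corrected by an element of `F` to do this for the finitely many
generators. Conversely, such an `e` slides all of `P` down to `F`, so `P` is generated by `-e`
modulo the group of `F`.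

Smoothness: in the half-space case the local rings along the orbit are localizations of a Laurent
polynomial ring with one polynomial variable adjoined (`formallySmooth_halfSpace`). Conversely, if
the localized monoid had an irreducible `c` not associated to an element `d` of least positive
height, the tangent vector with `χ^c ↦ ε`, `χ^d ↦ 0` would be obstructed by a binomial relation
between powers of `χ^c` and `χ^d` (`IsSmoothPoint.not_exists_tangent`). So `d` alone generates
modulo `F`, and since `P` generates `M` the half-space is reached. -/

theorem latticeVec_add {n : ℕ} (a b : Fin n → ℤ) :
    latticeVec (a + b) = latticeVec a + latticeVec b := by
  ext i; simp [latticeVec]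

theorem latticeVec_sub {n : ℕ} (a b : Fin n → ℤ) :
    latticeVec (a - b) = latticeVec a - latticeVec b := by
  ext i; simp [latticeVec]

theorem latticeVec_nsmul {n : ℕ} (k : ℕ) (a : Fin n → ℤ) :
    latticeVec (k • a) = (k : ℚ) • latticeVec a := by
  ext i; simp [latticeVec]

theorem latticeVec_injective {n : ℕ} : Function.Injective (latticeVec (n := n)) := by
  intro a b hab
  ext i
  have := congrFun hab i
  simpa [latticeVec] using this

theorem latticeVec_dotProduct {n : ℕ} (a b : Fin n → ℤ) :
    latticeVec a ⬝ᵥ latticeVec b = ((a ⬝ᵥ b : ℤ) : ℚ) := by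
  simp [latticeVec, dotProduct]

theorem latticeVec_ne_zero {n : ℕ} {a : Fin n → ℤ} (ha : a ≠ 0) : latticeVec a ≠ 0 := by
  intro h
  exact ha (latticeVec_injective (h.trans (by ext i; simp [latticeVec])))

theorem exists_nsmul_eq_latticeVec_of_mem_weightCone {n : ℕ} {P : AddSubmonoid (Fin n → ℤ)}
    {x : Fin n → ℚ} (hx : x ∈ weightCone P) :
    ∃ k : ℕ, 0 < k ∧ ∃ m ∈ P, (k : ℚ) • x = latticeVec m := by
  refine Submodule.span_induction (p := fun x _ => ∃ k : ℕ, 0 < k ∧ ∃ m ∈ P,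
    (k : ℚ) • x = latticeVec m) ?_ ?_ ?_ ?_ hx
  · rintro _ ⟨m, hm, rfl⟩
    exact ⟨1, one_pos, m, hm, by simp⟩
  · exact ⟨1, one_pos, 0, P.zero_mem, by ext i; simp [latticeVec]⟩
  · rintro x y - - ⟨k, hk, a, ha, hxa⟩ ⟨l, hl, b, hb, hyb⟩
    refine ⟨k * l, Nat.mul_pos hk hl, l • a + k • b,
      P.add_mem (P.nsmul_mem ha _) (P.nsmul_mem hb _), ?_⟩
    rw [latticeVec_add, latticeVec_nsmul, latticeVec_nsmul, ← hxa, ← hyb]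
    push_cast
    module
  · rintro ⟨c, hc⟩ x - ⟨k, hk, a, ha, hxa⟩
    have hc' : (0 : ℚ) ≤ c := hc
    refine ⟨c.den * k, Nat.mul_pos c.den_pos hk, c.num.toNat • a, P.nsmul_mem ha _, ?_⟩
    rw [latticeVec_nsmul, ← hxa]
    have h1 : ((c.num.toNat : ℕ) : ℚ) = c.num := by
      exact_mod_cast Int.toNat_of_nonneg (Rat.num_nonneg.2 hc')
    have h2 : (c.den : ℚ) * c = c.num := by rw [mul_comm]; exact Rat.mul_den_eq_num c
    rw [h1, ← h2]
    change ((c.den * k : ℕ) : ℚ) • (c • x) = _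
    push_cast
    module

/-- Clearing denominators; this removes the rational cone from the saturation condition. -/
theorem latticeVec_mem_weightCone_iff {n : ℕ} {P : AddSubmonoid (Fin n → ℤ)} {u : Fin n → ℤ} :
    latticeVec u ∈ weightCone P ↔ ∃ k : ℕ, 0 < k ∧ k • u ∈ P := by
  constructor
  · intro h
    obtain ⟨k, hk, m, hm, hkm⟩ := exists_nsmul_eq_latticeVec_of_mem_weightCone h
    rw [← latticeVec_nsmul] at hkm
    exact ⟨k, hk, latticeVec_injective hkm ▸ hm⟩
  · rintro ⟨k, hk, hku⟩
    have h : latticeVec (k • u) ∈ weightCone P :=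
      PointedCone.subset_hull (Set.mem_image_of_mem _ hku)
    have hk' : (k : ℚ) ≠ 0 := by exact_mod_cast hk.ne'
    have := (weightCone P).smul_mem (r := (k : ℚ)⁻¹) (by positivity) h
    convert this using 1
    rw [latticeVec_nsmul, smul_smul, inv_mul_cancel₀ hk', one_smul]

theorem latticeVec_mem_weightCone {n : ℕ} {P : AddSubmonoid (Fin n → ℤ)} {u : Fin n → ℤ}
    (hu : u ∈ P) : latticeVec u ∈ weightCone P :=
  PointedCone.subset_hull (Set.mem_image_of_mem _ hu)

theorem isSaturationPoint_iff {n : ℕ} {P : AddSubmonoid (Fin n → ℤ)} {p : Fin n → ℤ} :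
    IsSaturationPoint P p ↔
      p ∈ P ∧ ∀ u : Fin n → ℤ, (∃ k : ℕ, 0 < k ∧ k • u ∈ P) → p + u ∈ P := by
  refine and_congr_right fun _ => ⟨fun h u hu => ?_, fun h m hm => ?_⟩
  · exact h _ ⟨latticeVec u, latticeVec_mem_weightCone_iff.2 hu, latticeVec_add p u⟩
  · obtain ⟨c, hc, hmc⟩ := hm
    have : c = latticeVec (m - p) := by rw [latticeVec_sub, hmc, add_sub_cancel_left]
    have := h (m - p) (latticeVec_mem_weightCone_iff.1 (this ▸ hc))
    rwa [add_sub_cancel] at this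

theorem mem_fanCone_iff {n : ℕ} {P : AddSubmonoid (Fin n → ℤ)} {v : Fin n → ℚ} :
    v ∈ fanCone P ↔ ∀ m ∈ P, 0 ≤ latticeVec m ⬝ᵥ v := by
  rw [fanCone, weightCone, PointedCone.dual_hull, PointedCone.mem_dual]
  simp [dotProductBilin]

theorem mem_fanCone_iff_of_closure_eq {n : ℕ} {P : AddSubmonoid (Fin n → ℤ)}
    {G : Set (Fin n → ℤ)} (hG : AddSubmonoid.closure G = P) {v : Fin n → ℚ} :
    v ∈ fanCone P ↔ ∀ m ∈ G, 0 ≤ latticeVec m ⬝ᵥ v := by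
  rw [mem_fanCone_iff]
  constructor
  · intro h m hm
    exact h m (hG ▸ AddSubmonoid.subset_closure hm)
  · intro h m hm
    rw [← hG] at hm
    induction hm using AddSubmonoid.closure_induction with
    | mem x hx => exact h x hx
    | zero => simp [latticeVec, dotProduct]
    | add x y _ _ hx hy =>
      rw [latticeVec_add, add_dotProduct]
      exact add_nonneg hx hy

/-! ### Facets of the weight cone -/

/-- The monoid `P ∩ v^⊥`. -/
def faceMonoid {n : ℕ} (P : AddSubmonoid (Fin n → ℤ)) (v : Fin n → ℤ) :
    AddSubmonoid (Fin n → ℤ) where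
  carrier := {m | m ∈ P ∧ m ⬝ᵥ v = 0}
  zero_mem' := ⟨P.zero_mem, zero_dotProduct v⟩
  add_mem' := fun {a b} ha hb =>
    ⟨P.add_mem ha.1 hb.1, by rw [add_dotProduct, ha.2, hb.2, add_zero]⟩

/-- `v` is the inner normal vector of a facet of the cone over `P`: the monoid `P` lies in the
half-space `v ≥ 0`, but not in `v^⊥`, and `P ∩ v^⊥` spans `v^⊥` rationally. -/
structure IsFacetNormal {n : ℕ} (P : AddSubmonoid (Fin n → ℤ)) (v : Fin n → ℤ) : Prop where
  nonneg : ∀ m ∈ P, 0 ≤ m ⬝ᵥ v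
  exists_pos : ∃ m ∈ P, 0 < m ⬝ᵥ v
  exists_nsmul_eq_sub : ∀ w : Fin n → ℤ, w ⬝ᵥ v = 0 →
    ∃ k : ℕ, 0 < k ∧ ∃ a ∈ faceMonoid P v, ∃ b ∈ faceMonoid P v, k • w = a - b

/-- The localization of `P` at the facet with normal vector `v` is the monoid of all lattice
points of the half-space `v ≥ 0`. -/
def IsLocallyHalfSpace {n : ℕ} (P : AddSubmonoid (Fin n → ℤ)) (v : Fin n → ℤ) : Prop :=
  ∀ m : Fin n → ℤ, 0 ≤ m ⬝ᵥ v → ∃ q ∈ faceMonoid P v, m + q ∈ P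

theorem IsExtremalRay.exists_smul_eq {n : ℕ} {ρ σ : PointedCone ℚ (Fin n → ℚ)}
    (hρ : IsExtremalRay ρ σ) {x y : Fin n → ℚ} (hx : x ∈ ρ) (hx0 : x ≠ 0) (hy : y ∈ ρ) :
    ∃ c : ℚ, c • x = y := by
  let x' : Submodule.span ℚ (ρ : Set (Fin n → ℚ)) := ⟨x, Submodule.subset_span hx⟩
  let y' : Submodule.span ℚ (ρ : Set (Fin n → ℚ)) := ⟨y, Submodule.subset_span hy⟩
  have hx' : x' ≠ 0 := fun h => hx0 (congrArg Subtype.val h)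
  obtain ⟨c, hc⟩ := (finrank_eq_one_iff_of_nonzero' x' hx').1 hρ.2 y'
  exact ⟨c, congrArg Subtype.val hc⟩

section

variable {n : ℕ} {P : AddSubmonoid (Fin n → ℤ)}

theorem exists_dotProduct_ne_zero (hgen : AddSubgroup.closure (P : Set (Fin n → ℤ)) = ⊤)
    {v : Fin n → ℚ} (hv : v ≠ 0) : ∃ m ∈ P, latticeVec m ⬝ᵥ v ≠ 0 := by
  by_contra! h
  have key : ∀ m : Fin n → ℤ, latticeVec m ⬝ᵥ v = 0 := by
    intro m
    have hm : m ∈ AddSubgroup.closure (P : Set (Fin n → ℤ)) := hgen ▸ AddSubgroup.mem_top m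
    induction hm using AddSubgroup.closure_induction with
    | mem x hx => exact h x hx
    | zero => simp [latticeVec, dotProduct]
    | add x y _ _ hx hy => rw [latticeVec_add, add_dotProduct, hx, hy, add_zero]
    | neg x _ hx =>
      rw [← zero_sub, latticeVec_sub, sub_dotProduct, hx]
      simp [latticeVec, dotProduct]
  refine hv (funext fun i => ?_)
  have := key (Pi.single i 1)
  have h2 : latticeVec (Pi.single i (1 : ℤ)) = Pi.single i (1 : ℚ) := by
    ext j
    by_cases hj : j = i
    · subst hj; simp [latticeVec]
    · simp [latticeVec, hj]
  rw [h2] at this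
  simpa using this

theorem eq_zero_of_mem_fanCone_of_neg_mem
    (hgen : AddSubgroup.closure (P : Set (Fin n → ℤ)) = ⊤) {v : Fin n → ℚ}
    (hv : v ∈ fanCone P) (hv' : -v ∈ fanCone P) : v = 0 := by
  by_contra h
  obtain ⟨m, hm, hmv⟩ := exists_dotProduct_ne_zero hgen h
  have h1 := mem_fanCone_iff.1 hv m hm
  have h2 := mem_fanCone_iff.1 hv' m hm
  rw [dotProduct_neg] at h2
  exact hmv (by linarith)

theorem IsExtremalRay.exists_nonneg_smul_eq
    (hgen : AddSubgroup.closure (P : Set (Fin n → ℤ)) = ⊤) {ρ : PointedCone ℚ (Fin n → ℚ)}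
    (hρ : IsExtremalRay ρ (fanCone P)) {x y : Fin n → ℚ} (hx : x ∈ ρ) (hx0 : x ≠ 0)
    (hy : y ∈ ρ) : ∃ c : ℚ, 0 ≤ c ∧ c • x = y := by
  obtain ⟨c, hc⟩ := hρ.exists_smul_eq hx hx0 hy
  refine ⟨c, ?_, hc⟩
  by_contra! hneg
  refine hx0 (eq_zero_of_mem_fanCone_of_neg_mem hgen (hρ.1.le hx) ?_)
  have := (fanCone P).smul_mem (inv_nonneg.2 (neg_pos.2 hneg).le) (hρ.1.le hy)
  convert this using 1
  rw [← hc, smul_smul, inv_neg, neg_mul, inv_mul_cancel₀ hneg.ne, neg_one_smul]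

theorem IsExtremalRay.eq_of_mem
    (hgen : AddSubgroup.closure (P : Set (Fin n → ℤ)) = ⊤) {ρ ξ : PointedCone ℚ (Fin n → ℚ)}
    (hρ : IsExtremalRay ρ (fanCone P)) (hξ : IsExtremalRay ξ (fanCone P)) {x : Fin n → ℚ}
    (hx0 : x ≠ 0) (hxρ : x ∈ ρ) (hxξ : x ∈ ξ) : ξ = ρ := by
  apply le_antisymm
  · intro y hy
    obtain ⟨c, hc, rfl⟩ := hξ.exists_nonneg_smul_eq hgen hxξ hx0 hy
    exact ρ.smul_mem hc hxρ
  · intro y hy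
    obtain ⟨c, hc, rfl⟩ := hρ.exists_nonneg_smul_eq hgen hxρ hx0 hy
    exact ξ.smul_mem hc hxξ

/-- If `v ∈ σ` and `u` is nonnegative on all generators of `P` on which `v`
vanishes, then `N v + u ∈ σ` for large `N`. -/
theorem exists_nat_smul_add_mem_fanCone {G : Finset (Fin n → ℤ)}
    (hG : AddSubmonoid.closure (G : Set (Fin n → ℤ)) = P) {v : Fin n → ℤ}
    (hv : latticeVec v ∈ fanCone P) (u : Fin n → ℚ)
    (hu : ∀ g ∈ G, g ⬝ᵥ v = 0 → 0 ≤ latticeVec g ⬝ᵥ u) :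
    ∃ N₀ : ℕ, ∀ N : ℕ, N₀ ≤ N → (N : ℚ) • latticeVec v + u ∈ fanCone P := by
  -- A generator off `v^⊥` has height at least one by integrality, so a multiple of `v` exceeding
  -- every `|⟨g, u⟩|` compensates `u` on it.
  obtain ⟨N₀, hN₀⟩ := exists_nat_ge (∑ g ∈ G, |latticeVec g ⬝ᵥ u|)
  refine ⟨N₀, fun N hN => (mem_fanCone_iff_of_closure_eq hG).2 fun g hg => ?_⟩
  rw [dotProduct_add, dotProduct_smul, latticeVec_dotProduct, smul_eq_mul]
  have hgv := (mem_fanCone_iff_of_closure_eq hG).1 hv g hg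
  rw [latticeVec_dotProduct] at hgv
  have hgv : 0 ≤ g ⬝ᵥ v := by exact_mod_cast hgv
  rcases hgv.eq_or_lt with h0 | hpos
  · rw [← h0]
    simpa using hu g hg h0.symm
  · have h1 : (1 : ℚ) ≤ ((g ⬝ᵥ v : ℤ) : ℚ) := by exact_mod_cast hpos
    have h2 : |latticeVec g ⬝ᵥ u| ≤ ∑ g ∈ G, |latticeVec g ⬝ᵥ u| :=
      Finset.single_le_sum (f := fun g => |latticeVec g ⬝ᵥ u|) (fun _ _ => abs_nonneg _) hg
    have h3 : (N₀ : ℚ) ≤ N := by exact_mod_cast hN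
    have h4 := neg_abs_le (latticeVec g ⬝ᵥ u)
    nlinarith [abs_nonneg (latticeVec g ⬝ᵥ u)]

theorem exists_nsmul_eq_sub_of_mem_span {Q : AddSubmonoid (Fin n → ℤ)} {x : Fin n → ℚ}
    (hx : x ∈ Submodule.span ℚ (latticeVec '' (Q : Set (Fin n → ℤ)))) :
    ∃ k : ℕ, 0 < k ∧ ∃ a ∈ Q, ∃ b ∈ Q, (k : ℚ) • x = latticeVec a - latticeVec b := by
  induction hx using Submodule.span_induction with
  | mem x hx =>
    obtain ⟨m, hm, rfl⟩ := hx
    exact ⟨1, one_pos, m, hm, 0, Q.zero_mem, by ext i; simp [latticeVec]⟩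
  | zero => exact ⟨1, one_pos, 0, Q.zero_mem, 0, Q.zero_mem, by ext i; simp [latticeVec]⟩
  | add x y _ _ hx hy =>
    obtain ⟨k, hk, a, ha, b, hb, hxk⟩ := hx
    obtain ⟨l, hl, c, hc, d, hd, hyl⟩ := hy
    refine ⟨k * l, Nat.mul_pos hk hl, l • a + k • c,
      Q.add_mem (Q.nsmul_mem ha _) (Q.nsmul_mem hc _), l • b + k • d,
      Q.add_mem (Q.nsmul_mem hb _) (Q.nsmul_mem hd _), ?_⟩
    simp only [latticeVec_add, latticeVec_nsmul]
    push_cast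
    calc ((k : ℚ) * l) • (x + y) = (l : ℚ) • (k : ℚ) • x + (k : ℚ) • (l : ℚ) • y := by module
      _ = _ := by rw [hxk, hyl]; module
  | smul c x _ hx =>
    obtain ⟨k, hk, a, ha, b, hb, hxk⟩ := hx
    have h2 : (c.den : ℚ) * c = c.num := by rw [mul_comm]; exact Rat.mul_den_eq_num c
    have h3 : ((c.den * k : ℕ) : ℚ) • c • x = (c.num : ℚ) • (latticeVec a - latticeVec b) := by
      rw [← hxk, ← h2]
      push_cast
      module
    rcases le_total 0 c.num with h | h
    · refine ⟨c.den * k, Nat.mul_pos c.den_pos hk, c.num.toNat • a, Q.nsmul_mem ha _,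
        c.num.toNat • b, Q.nsmul_mem hb _, ?_⟩
      have h1 : ((c.num.toNat : ℕ) : ℚ) = c.num := by exact_mod_cast Int.toNat_of_nonneg h
      rw [h3, latticeVec_nsmul, latticeVec_nsmul, h1, smul_sub]
    · refine ⟨c.den * k, Nat.mul_pos c.den_pos hk, (-c.num).toNat • b, Q.nsmul_mem hb _,
        (-c.num).toNat • a, Q.nsmul_mem ha _, ?_⟩
      have h1 : (((-c.num).toNat : ℕ) : ℚ) = -c.num := by
        exact_mod_cast Int.toNat_of_nonneg (neg_nonneg.2 h)
      rw [h3, latticeVec_nsmul, latticeVec_nsmul, h1]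
      module

/-- By duality the spanning condition says that only multiples of `v` annihilate `F`. If `u`
annihilates `F`, then `N v + u` and `N v - u` lie in `σ` for large `N`; their sum lies on the ray,
so both do because the ray is a face, and `u` is proportional to `v`. -/
theorem IsExtremalRay.isFacetNormal (hfg : P.FG)
    (hgen : AddSubgroup.closure (P : Set (Fin n → ℤ)) = ⊤) {ρ : PointedCone ℚ (Fin n → ℚ)}
    (hρ : IsExtremalRay ρ (fanCone P)) {v : Fin n → ℤ} (hv : latticeVec v ∈ ρ) (hv0 : v ≠ 0) :
    IsFacetNormal P v := by
  obtain ⟨G, hG⟩ := hfg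
  have hvσ := hρ.1.le hv
  have hnonneg : ∀ m ∈ P, 0 ≤ m ⬝ᵥ v := by
    intro m hm
    have := mem_fanCone_iff.1 hvσ m hm
    rw [latticeVec_dotProduct] at this
    exact_mod_cast this
  refine ⟨hnonneg, ?_, ?_⟩
  · obtain ⟨m, hm, hmv⟩ := exists_dotProduct_ne_zero hgen (latticeVec_ne_zero hv0)
    rw [latticeVec_dotProduct] at hmv
    exact ⟨m, hm, lt_of_le_of_ne (hnonneg m hm) (by exact_mod_cast hmv.symm)⟩
  · have hperp : ∀ u : Fin n → ℚ, (∀ g ∈ faceMonoid P v, latticeVec g ⬝ᵥ u = 0) →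
        ∃ c : ℚ, c • latticeVec v = u := by
      intro u hu
      have hu' : ∀ g ∈ G, g ⬝ᵥ v = 0 → latticeVec g ⬝ᵥ u = 0 := fun g hg hgv =>
        hu g ⟨hG ▸ AddSubmonoid.subset_closure hg, hgv⟩
      obtain ⟨N₁, h₁⟩ := exists_nat_smul_add_mem_fanCone hG hvσ u fun g hg hgv => (hu' g hg hgv).ge
      obtain ⟨N₂, h₂⟩ := exists_nat_smul_add_mem_fanCone hG hvσ (-u) fun g hg hgv => by
        rw [dotProduct_neg, hu' g hg hgv, neg_zero]
      have h₁ := h₁ (max N₁ N₂) (le_max_left _ _)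
      have h₂ := h₂ (max N₁ N₂) (le_max_right _ _)
      have hsum : ((max N₁ N₂ : ℕ) : ℚ) • latticeVec v + u +
          (((max N₁ N₂ : ℕ) : ℚ) • latticeVec v + -u) ∈ ρ := by
        have := ρ.smul_mem (r := 2 * ((max N₁ N₂ : ℕ) : ℚ)) (by positivity) hv
        convert this using 1
        module
      obtain ⟨c, hc⟩ := hρ.exists_smul_eq hv (latticeVec_ne_zero hv0)
        (hρ.1.mem_of_add_mem_left h₁ h₂ hsum)
      exact ⟨c - (max N₁ N₂ : ℕ), by rw [sub_smul, hc, add_sub_cancel_left]⟩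
    intro w hw
    have hmem : latticeVec w ∈
        Submodule.span ℚ (latticeVec '' (faceMonoid P v : Set (Fin n → ℤ))) := by
      -- A functional separating `w` from the span of `F` is a multiple of `v`, hence vanishes on
      -- `w`.
      by_contra hnot
      obtain ⟨f, hfw, hf⟩ := Submodule.exists_le_ker_of_notMem hnot
      have hfd : ∀ x, f x = x ⬝ᵥ fun i => f (Pi.single i 1) := by
        intro x
        conv_lhs => rw [← Finset.univ_sum_single x, map_sum]
        refine Finset.sum_congr rfl fun i _ => ?_
        rw [← smul_eq_mul, ← map_smul, ← Pi.single_smul, smul_eq_mul, mul_one]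
      obtain ⟨c, hc⟩ := hperp (fun i => f (Pi.single i 1)) fun g hg => by
        rw [← hfd]
        exact hf (Submodule.subset_span ⟨g, hg, rfl⟩)
      apply hfw
      rw [hfd, ← hc, dotProduct_smul, latticeVec_dotProduct, hw]
      simp
    obtain ⟨k, hk, a, ha, b, hb, h⟩ := exists_nsmul_eq_sub_of_mem_span hmem
    refine ⟨k, hk, a, ha, b, hb, latticeVec_injective ?_⟩
    rw [latticeVec_nsmul, h, latticeVec_sub]

theorem latticeVec_mem_dualFace_iff {ρ : PointedCone ℚ (Fin n → ℚ)}
    (hρ : IsExtremalRay ρ (fanCone P)) {v : Fin n → ℤ} (hv : latticeVec v ∈ ρ) (hv0 : v ≠ 0)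
    {m : Fin n → ℤ} (hm : m ∈ P) : latticeVec m ∈ dualFace P ρ ↔ m ⬝ᵥ v = 0 := by
  constructor
  · intro h
    have := h.2 _ hv
    rw [latticeVec_dotProduct] at this
    exact_mod_cast this
  · intro h
    refine ⟨latticeVec_mem_weightCone hm, fun w hw => ?_⟩
    obtain ⟨c, rfl⟩ := hρ.exists_smul_eq hv (latticeVec_ne_zero hv0) hw
    rw [dotProduct_smul, latticeVec_dotProduct, h]
    simp

theorem isAlmostSaturated_dualFace_iff {ρ : PointedCone ℚ (Fin n → ℚ)}
    (hρ : IsExtremalRay ρ (fanCone P)) {v : Fin n → ℤ} (hv : latticeVec v ∈ ρ) (hv0 : v ≠ 0) :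
    IsAlmostSaturated P (dualFace P ρ) ↔ ∃ p ∈ faceMonoid P v,
      ∀ u : Fin n → ℤ, (∃ k : ℕ, 0 < k ∧ k • u ∈ P) → p + u ∈ P := by
  constructor
  · rintro ⟨p, hp, hpρ⟩
    rw [isSaturationPoint_iff] at hp
    exact ⟨p, ⟨hp.1, (latticeVec_mem_dualFace_iff hρ hv hv0 hp.1).1 hpρ⟩, hp.2⟩
  · rintro ⟨p, hp, h⟩
    exact ⟨p, isSaturationPoint_iff.2 ⟨hp.1, h⟩,
      (latticeVec_mem_dualFace_iff hρ hv hv0 hp.1).2 hp.2⟩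

/-! ### Almost saturated facets -/

variable {v : Fin n → ℤ}

/-- With `e ∈ P` of positive height, `m` is rationally a positive multiple of `e` plus a difference
`a - b` of face elements. Adding `b` puts a multiple of `m + b` into `P`, and the saturation point
then puts `p + m + b` itself there. -/
theorem IsFacetNormal.isLocallyHalfSpace_of_saturation (hv : IsFacetNormal P v)
    {p : Fin n → ℤ} (hp : p ∈ faceMonoid P v)
    (hsat : ∀ u : Fin n → ℤ, (∃ k : ℕ, 0 < k ∧ k • u ∈ P) → p + u ∈ P) :
    IsLocallyHalfSpace P v := by
  intro m hm
  obtain ⟨e, he, hev⟩ := hv.exists_pos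
  obtain ⟨K, hK, a, ha, b, hb, hKab⟩ := hv.exists_nsmul_eq_sub
    ((e ⬝ᵥ v) • m - (m ⬝ᵥ v) • e) (by
      rw [sub_dotProduct, smul_dotProduct, smul_dotProduct, smul_eq_mul, smul_eq_mul, mul_comm,
        sub_self])
  refine ⟨p + b, add_mem hp hb, ?_⟩
  obtain ⟨s, hs⟩ := Int.eq_ofNat_of_zero_le hm
  obtain ⟨t, ht⟩ := Int.eq_ofNat_of_zero_le hev.le
  rw [hs, ht] at hKab
  have ht0 : 0 < t := by omega
  have hKt : 0 < K * t := Nat.mul_pos hK ht0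
  have h : (K * t) • (m + b) ∈ P := by
    have : (K * t) • (m + b) = a + (K * s) • e + (K * t - 1) • b := by
      have h1 : (K * t) • b = b + (K * t - 1) • b := by
        conv_lhs => rw [show K * t = (K * t - 1) + 1 by omega]
        rw [succ_nsmul, add_comm]
      have h2 : (K * t) • m = a - b + (K * s) • e := by
        rw [← hKab]
        simp only [natCast_zsmul, smul_sub, smul_smul]
        abel
      rw [smul_add, h1, h2]
      abel
    rw [this]
    exact P.add_mem (P.add_mem ha.1 (P.nsmul_mem he _)) (P.nsmul_mem hb.1 _)
  have := hsat (m + b) ⟨K * t, hKt, h⟩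
  convert this using 1
  abel

/-- As in Gordan's lemma: write `k • u` as a combination of the generators and take integer parts of
the coefficients divided by `k`. The remainder has coefficients in `[0, 1)`, whence the box. -/
theorem exists_sub_mem_box {G : Finset (Fin n → ℤ)}
    (hG : AddSubmonoid.closure (G : Set (Fin n → ℤ)) = P) {u : Fin n → ℤ}
    (hu : ∃ k : ℕ, 0 < k ∧ k • u ∈ P) :
    ∃ a ∈ P, (∃ k : ℕ, 0 < k ∧ k • (u - a) ∈ P) ∧
      u - a ∈ Set.Icc (-∑ g ∈ G, |g|) (∑ g ∈ G, |g|) := by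
  obtain ⟨k, hk, hku⟩ := hu
  have hmem : ∀ g ∈ G, g ∈ P := fun g hg => hG ▸ AddSubmonoid.subset_closure hg
  rw [← hG, AddSubmonoid.mem_closure_finset] at hku
  obtain ⟨f, -, hf⟩ := hku
  have hdec : k • (u - ∑ g ∈ G, (f g / k) • g) = ∑ g ∈ G, (f g % k) • g := by
    rw [smul_sub, ← hf, Finset.smul_sum, ← Finset.sum_sub_distrib]
    refine Finset.sum_congr rfl fun g _ => ?_
    rw [sub_eq_iff_eq_add, smul_smul, ← add_smul, Nat.mod_add_div]
  have hbound : ∀ i, |(u - ∑ g ∈ G, (f g / k) • g) i| ≤ (∑ g ∈ G, |g|) i := by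
    intro i
    have h1 := congrFun hdec i
    rw [Pi.smul_apply, Finset.sum_apply, nsmul_eq_mul] at h1
    refine le_of_mul_le_mul_left (a := (k : ℤ)) ?_ (by exact_mod_cast hk)
    rw [← Nat.abs_cast k, ← abs_mul, h1, Nat.abs_cast, Finset.sum_apply, Finset.mul_sum]
    refine (Finset.abs_sum_le_sum_abs _ _).trans (Finset.sum_le_sum fun g _ => ?_)
    rw [Pi.smul_apply, nsmul_eq_mul, abs_mul, Nat.abs_cast, Pi.abs_apply]
    exact mul_le_mul_of_nonneg_right (by exact_mod_cast (Nat.mod_lt _ hk).le) (abs_nonneg _)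
  refine ⟨∑ g ∈ G, (f g / k) • g, sum_mem fun g hg => P.nsmul_mem (hmem g hg) _,
    ⟨k, hk, ?_⟩, ?_⟩
  · rw [hdec]
    exact sum_mem fun g hg => P.nsmul_mem (hmem g hg) _
  · exact ⟨fun i => (abs_le.1 (hbound i)).1, fun i => (abs_le.1 (hbound i)).2⟩

/-- Only the finitely many points of the box need a correction from `F`. The sum of all these
corrections works for every one of them, the surplus terms being in `P`. -/
theorem IsLocallyHalfSpace.exists_saturation (hloc : IsLocallyHalfSpace P v) (hfg : P.FG)
    (hv : IsFacetNormal P v) : ∃ p ∈ faceMonoid P v,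
      ∀ u : Fin n → ℤ, (∃ k : ℕ, 0 < k ∧ k • u ∈ P) → p + u ∈ P := by
  obtain ⟨G, hG⟩ := hfg
  have hnonneg : ∀ u : Fin n → ℤ, (∃ k : ℕ, 0 < k ∧ k • u ∈ P) → 0 ≤ u ⬝ᵥ v := by
    rintro u ⟨k, hk, hku⟩
    have := hv.nonneg _ hku
    rw [smul_dotProduct, nsmul_eq_mul] at this
    exact nonneg_of_mul_nonneg_right this (by exact_mod_cast hk)
  have hq : ∀ u : Fin n → ℤ, ∃ q ∈ faceMonoid P v, 0 ≤ u ⬝ᵥ v → u + q ∈ P := by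
    intro u
    by_cases hu : 0 ≤ u ⬝ᵥ v
    · obtain ⟨q, hq, huq⟩ := hloc u hu
      exact ⟨q, hq, fun _ => huq⟩
    · exact ⟨0, zero_mem _, fun h => absurd h hu⟩
  choose q hqmem hq using hq
  let U : Finset (Fin n → ℤ) := Finset.Icc (-∑ g ∈ G, |g|) (∑ g ∈ G, |g|)
  refine ⟨∑ u ∈ U, q u, sum_mem fun u _ => hqmem u, fun u hu => ?_⟩
  obtain ⟨a, ha, hua, hbox⟩ := exists_sub_mem_box hG hu
  have hboxU : u - a ∈ U := by simpa [U] using hbox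
  have h1 := hq (u - a) (hnonneg _ hua)
  classical
  have h2 : ∑ u ∈ U, q u + u = ((u - a) + q (u - a)) + ∑ x ∈ U.erase (u - a), q x + a := by
    rw [← Finset.add_sum_erase _ _ hboxU]
    abel
  rw [h2]
  exact P.add_mem (P.add_mem h1 (sum_mem fun x _ => (hqmem x).1)) ha

theorem isAlmostSaturated_iff_isLocallyHalfSpace (hfg : P.FG)
    {ρ : PointedCone ℚ (Fin n → ℚ)} (hρ : IsExtremalRay ρ (fanCone P))
    (hvρ : latticeVec v ∈ ρ) (hv0 : v ≠ 0) (hv : IsFacetNormal P v) :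
    IsAlmostSaturated P (dualFace P ρ) ↔ IsLocallyHalfSpace P v := by
  rw [isAlmostSaturated_dualFace_iff hρ hvρ hv0]
  exact ⟨fun ⟨p, hp, h⟩ => hv.isLocallyHalfSpace_of_saturation hp h,
    fun h => h.exists_saturation hfg hv⟩

/-- If `P` is contained in `P ∩ v^⊥ + ℕ c` up to differences of elements of `P ∩ v^⊥`, then
the localization of `P` at the facet is a half-space. -/
theorem isLocallyHalfSpace_of_generator
    (hgen : AddSubgroup.closure (P : Set (Fin n → ℤ)) = ⊤) {c q₀ : Fin n → ℤ}
    (hc : 0 < c ⬝ᵥ v) (hq₀ : q₀ ∈ faceMonoid P v) (hcq : c + q₀ ∈ P)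
    (h : ∀ m ∈ P, ∃ j : ℤ, ∃ a ∈ faceMonoid P v, ∃ b ∈ faceMonoid P v, m + a = j • c + b) :
    IsLocallyHalfSpace P v := by
  -- Modulo the group of `F` the hypothesis is additive and symmetric, so it passes from `P` to all
  -- of `M`; the exponent `j` is then nonnegative by comparing heights.
  have key : ∀ m : Fin n → ℤ, ∃ j : ℤ, ∃ a ∈ faceMonoid P v, ∃ b ∈ faceMonoid P v,
      m + a = j • c + b := by
    intro m
    have hm : m ∈ AddSubgroup.closure (P : Set (Fin n → ℤ)) := hgen ▸ AddSubgroup.mem_top m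
    induction hm using AddSubgroup.closure_induction with
    | mem x hx => exact h x hx
    | zero => exact ⟨0, 0, zero_mem _, 0, zero_mem _, by simp⟩
    | add x y _ _ hx hy =>
      obtain ⟨j, a, ha, b, hb, e⟩ := hx
      obtain ⟨j', a', ha', b', hb', e'⟩ := hy
      refine ⟨j + j', a + a', add_mem ha ha', b + b', add_mem hb hb', ?_⟩
      rw [add_add_add_comm, e, e', add_smul]
      abel
    | neg x _ hx =>
      obtain ⟨j, a, ha, b, hb, e⟩ := hx
      refine ⟨-j, b, hb, a, ha, ?_⟩
      rw [neg_smul, neg_add_eq_iff_eq_add, ← add_assoc, ← sub_eq_add_neg,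
        eq_comm, sub_add_eq_add_sub, e, add_sub_cancel_left]
  intro m hm
  obtain ⟨j, a, ha, b, hb, e⟩ := key m
  have hj : 0 ≤ j := by
    have := congrArg (· ⬝ᵥ v) e
    simp only [add_dotProduct, smul_dotProduct, ha.2, hb.2, add_zero, smul_eq_mul] at this
    rw [this] at hm
    exact nonneg_of_mul_nonneg_left hm hc
  obtain ⟨s, rfl⟩ := Int.eq_ofNat_of_zero_le hj
  -- Each of the `s` copies of `c` needs its own `q₀` to land in `P`.
  refine ⟨a + s • q₀, add_mem ha (nsmul_mem hq₀ _), ?_⟩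
  rw [← add_assoc, e, natCast_zsmul]
  have : s • c + b + s • q₀ = s • (c + q₀) + b := by rw [smul_add]; abel
  rw [this]
  exact P.add_mem (P.nsmul_mem hcq _) hb.1

end

/-! ### Demazure roots -/

section

variable {n : ℕ} {P : AddSubmonoid (Fin n → ℤ)} {v : Fin n → ℤ}

/-- The values `⟨·, v⟩` form a principal ideal whose generator divides every coordinate of `v`, so
primitivity makes it a unit. -/
theorem exists_dotProduct_eq_neg_one
    (hprim : ∀ (k : ℤ) (u : Fin n → ℤ), v = k • u → IsUnit k) :
    ∃ e : Fin n → ℤ, e ⬝ᵥ v = -1 := by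
  let I : Submodule ℤ ℤ := LinearMap.range ((dotProductBilin ℤ ℤ).flip v : (Fin n → ℤ) →ₗ[ℤ] ℤ)
  obtain ⟨d, hd⟩ := (IsPrincipalIdealRing.principal (R := ℤ) I).principal
  have hmem : ∀ i, ∃ c : ℤ, c • d = v i := by
    intro i
    have : v i ∈ I := ⟨Pi.single i 1, by simp [dotProductBilin]⟩
    rw [hd] at this
    exact Submodule.mem_span_singleton.1 this
  choose u hu using hmem
  have hunit : IsUnit d := hprim d u (by
    ext i
    rw [Pi.smul_apply, ← hu i, smul_eq_mul, smul_eq_mul, mul_comm])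
  have : (-1 : ℤ) ∈ I := by
    rw [hd, Submodule.mem_span_singleton]
    obtain ⟨w, hw⟩ := hunit.exists_left_inv
    exact ⟨-w, by rw [smul_eq_mul, neg_mul, hw]⟩
  obtain ⟨e, he⟩ := this
  exact ⟨e, he⟩

/-- In a sum of positive height some summand has positive height; shifting that one by `e` is
enough. -/
theorem IsFacetNormal.add_mem_of_generators (hv : IsFacetNormal P v)
    {G : Finset (Fin n → ℤ)} (hG : AddSubmonoid.closure (G : Set (Fin n → ℤ)) = P)
    {e : Fin n → ℤ} (he : ∀ g ∈ G, 0 < g ⬝ᵥ v → g + e ∈ P) :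
    ∀ m ∈ P, 0 < m ⬝ᵥ v → m + e ∈ P := by
  intro m hm
  rw [← hG] at hm
  induction hm using AddSubmonoid.closure_induction with
  | mem x hx => exact he x hx
  | zero => intro h; simp at h
  | add x y hx hy ihx ihy =>
    rw [hG] at hx hy
    intro h
    rw [add_dotProduct] at h
    rcases (hv.nonneg x hx).eq_or_lt with hx0 | hx0
    · rw [add_assoc]
      exact P.add_mem hx (ihy (by omega))
    · rw [add_right_comm]
      exact P.add_mem (ihx hx0) hy

/-- Adding elements of `F` to `e` does not change its height, so the corrections required by the
individual generators can all be added at once. -/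
theorem IsLocallyHalfSpace.exists_root (hloc : IsLocallyHalfSpace P v) (hfg : P.FG)
    (hv : IsFacetNormal P v)
    (hprim : ∀ (k : ℤ) (u : Fin n → ℤ), v = k • u → IsUnit k) :
    ∃ e : Fin n → ℤ, e ⬝ᵥ v = -1 ∧ ∀ m ∈ P, 0 < m ⬝ᵥ v → m + e ∈ P := by
  obtain ⟨G, hG⟩ := hfg
  obtain ⟨e, he⟩ := exists_dotProduct_eq_neg_one hprim
  have hq : ∀ g : Fin n → ℤ, ∃ q ∈ faceMonoid P v, 0 < g ⬝ᵥ v → g + e + q ∈ P := by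
    intro g
    by_cases hg : 0 < g ⬝ᵥ v
    · obtain ⟨q, hq, h⟩ := hloc (g + e) (by rw [add_dotProduct, he]; omega)
      exact ⟨q, hq, fun _ => h⟩
    · exact ⟨0, zero_mem _, fun h => absurd h hg⟩
  choose q hqmem hq using hq
  have hsum : ∑ g ∈ G, q g ∈ faceMonoid P v := sum_mem fun g _ => hqmem g
  refine ⟨e + ∑ g ∈ G, q g, by rw [add_dotProduct, he, hsum.2, add_zero],
    hv.add_mem_of_generators hG fun g hg hgv => ?_⟩
  classical
  have : g + (e + ∑ g ∈ G, q g) = g + e + q g + ∑ x ∈ G.erase g, q x := by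
    rw [← Finset.add_sum_erase _ _ hg]
    abel
  rw [this]
  exact P.add_mem (hq g hgv) (sum_mem fun x _ => (hqmem x).1)

/-- If a generator `g` lies on `w^⊥` but off `v^⊥`, then `g + e ∈ P` gives `⟨e, w⟩ = ⟨g + e, w⟩ ≥
0`. -/
theorem mem_demazureRoots (hfg : P.FG) (hgen : AddSubgroup.closure (P : Set (Fin n → ℤ)) = ⊤)
    {ρ : PointedCone ℚ (Fin n → ℚ)} (hρ : IsExtremalRay ρ (fanCone P))
    (hvρ : IsPrimitiveVectorOn ρ v) {e : Fin n → ℤ}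
    (hev : e ⬝ᵥ v = -1) (he : ∀ m ∈ P, 0 < m ⬝ᵥ v → m + e ∈ P) : e ∈ demazureRoots P ρ := by
  obtain ⟨G, hG⟩ := hfg
  refine ⟨⟨v, hvρ, hev⟩, fun ξ hξ hne w hw => ?_⟩
  have hwσ := hξ.1.le hw.1
  have hvσ := hρ.1.le hvρ.1
  have hPw : ∀ m ∈ P, 0 ≤ m ⬝ᵥ w := by
    intro m hm
    have := mem_fanCone_iff.1 hwσ m hm
    rw [latticeVec_dotProduct] at this
    exact_mod_cast this
  by_cases h : ∃ g ∈ G, 0 < g ⬝ᵥ v ∧ g ⬝ᵥ w = 0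
  · obtain ⟨g, hg, hgv, hgw⟩ := h
    have := hPw _ (he g (hG ▸ AddSubmonoid.subset_closure hg) hgv)
    rwa [add_dotProduct, hgw, zero_add] at this
  · push Not at h
    -- Without such a generator `N w - v` lies in `σ` for some `N`, so `v` is a summand of a point
    -- of the ray `ξ`, hence lies on it, and the rays coincide.
    exfalso
    obtain ⟨N, hN⟩ := exists_nat_smul_add_mem_fanCone hG hwσ (-latticeVec v)
      fun g hg hgw => by
        rw [dotProduct_neg, latticeVec_dotProduct, Left.nonneg_neg_iff]
        by_contra hgv
        exact h g hg (by push Not at hgv; exact_mod_cast hgv) hgw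
    have hN := hN N le_rfl
    have hmem : latticeVec v + ((N : ℚ) • latticeVec w + -latticeVec v) ∈ ξ := by
      have := ξ.smul_mem (r := (N : ℚ)) (by positivity) hw.1
      convert this using 1
      abel
    exact hne (hρ.eq_of_mem hgen hξ (latticeVec_ne_zero hvρ.2.1) hvρ.1
      (hξ.1.mem_of_add_mem_left hvσ hN hmem))

/-- Identifies the vector quantified inside `demazureRoots` with the given one. Pairing with `e`
shows that the ratio of the two vectors is an integer; primitivity and nonnegativity make it one. -/
theorem IsPrimitiveVectorOn.eq (hgen : AddSubgroup.closure (P : Set (Fin n → ℤ)) = ⊤)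
    {ρ : PointedCone ℚ (Fin n → ℚ)} (hρ : IsExtremalRay ρ (fanCone P)) {w e : Fin n → ℤ}
    (hv : IsPrimitiveVectorOn ρ v) (hw : IsPrimitiveVectorOn ρ w) (he : e ⬝ᵥ w = -1) :
    v = w := by
  obtain ⟨c, hc, hcv⟩ :=
    hρ.exists_nonneg_smul_eq hgen hw.1 (latticeVec_ne_zero hw.2.1) hv.1
  have hce : c = ((-(e ⬝ᵥ v) : ℤ) : ℚ) := by
    have h1 : latticeVec e ⬝ᵥ (c • latticeVec w) = latticeVec e ⬝ᵥ latticeVec v := by rw [hcv]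
    rw [dotProduct_smul, latticeVec_dotProduct, latticeVec_dotProduct, he] at h1
    push_cast at h1 ⊢
    simp only [smul_eq_mul] at h1
    linarith
  have hvw : v = (-(e ⬝ᵥ v)) • w := by
    apply latticeVec_injective
    rw [← hcv, hce]
    ext i
    simp [latticeVec]
  have hu := hv.2.2 _ _ hvw
  have hnn : 0 ≤ -(e ⬝ᵥ v) := by
    rw [hce] at hc
    exact_mod_cast hc
  rcases Int.isUnit_iff.1 hu with h | h
  · rw [h, one_smul] at hvw
    exact hvw
  · omega

/-- Adding `e` as many times as the height of `m` brings `m` down into `F`, so `-e` generates `P`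
modulo `F`. -/
theorem IsFacetNormal.isLocallyHalfSpace_of_root (hv : IsFacetNormal P v)
    (hgen : AddSubgroup.closure (P : Set (Fin n → ℤ)) = ⊤) {e : Fin n → ℤ}
    (hev : e ⬝ᵥ v = -1) (he : ∀ m ∈ P, 0 < m ⬝ᵥ v → m + e ∈ P) : IsLocallyHalfSpace P v := by
  have key : ∀ (k : ℕ), ∀ m ∈ P, (k : ℤ) ≤ m ⬝ᵥ v → m + k • e ∈ P := by
    intro k
    induction k with
    | zero => intro m hm _; simpa using hm
    | succ k ih =>
      intro m hm hk
      push_cast at hk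
      have h1 := ih m hm (by omega)
      have h2 := he _ h1 (by
        rw [add_dotProduct, smul_dotProduct, hev, nsmul_eq_mul]
        omega)
      rwa [add_assoc, ← succ_nsmul] at h2
  have hface : ∀ m ∈ P, m + (m ⬝ᵥ v) • e ∈ faceMonoid P v := by
    intro m hm
    obtain ⟨k, hk⟩ := Int.eq_ofNat_of_zero_le (hv.nonneg m hm)
    refine ⟨?_, by rw [add_dotProduct, smul_dotProduct, hev]; simp⟩
    have := key k m hm hk.ge
    rwa [hk, natCast_zsmul]
  obtain ⟨m, hm, hmv⟩ := hv.exists_pos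
  refine isLocallyHalfSpace_of_generator hgen (c := -e) (by rw [neg_dotProduct, hev]; simp)
    (hface m hm) ?_ fun m hm => ⟨m ⬝ᵥ v, 0, zero_mem _, _, hface m hm, ?_⟩
  -- Stopping one step before the facet exhibits `-e` plus a face element as an element of `P`.
  · obtain ⟨k, hk⟩ := Int.eq_ofNat_of_zero_le hmv.le
    have hk0 : k ≠ 0 := by omega
    obtain ⟨l, rfl⟩ := Nat.exists_eq_succ_of_ne_zero hk0
    have := key l m hm (by rw [hk]; simp)
    convert this using 1
    rw [hk, natCast_zsmul, succ_nsmul]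
    abel
  · rw [smul_neg]
    abel

end

/-! ### The coordinate algebra -/

section

variable {K : Type*} [Field K] {n : ℕ} {P : AddSubmonoid (Fin n → ℤ)} {v : Fin n → ℤ}

theorem mem_coordRing {f : AddMonoidAlgebra K (Fin n → ℤ)} :
    f ∈ coordRing K P ↔ ∀ m ∉ P, f.coeff m = 0 := by
  change f ∈ AddMonoidAlgebra.supported K K (P : Set (Fin n → ℤ)) ↔ _
  rw [AddMonoidAlgebra.mem_supported']
  rfl

theorem chi_coe (m : P) : (chi K P m : AddMonoidAlgebra K (Fin n → ℤ)) =
    AddMonoidAlgebra.single (m : Fin n → ℤ) 1 := rfl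

theorem single_mem_coordRing {m : Fin n → ℤ} (hm : m ∈ P) (c : K) :
    AddMonoidAlgebra.single m c ∈ coordRing K P := by
  have := (coordRing K P).smul_mem (chi K P ⟨m, hm⟩).2 c
  rwa [chi_coe, AddMonoidAlgebra.smul_single, smul_eq_mul, mul_one] at this

theorem mem_of_single_mem_coordRing {m : Fin n → ℤ} {c : K} (hc : c ≠ 0)
    (h : AddMonoidAlgebra.single m c ∈ coordRing K P) : m ∈ P := by
  by_contra hm
  have := mem_coordRing.1 h m hm
  simp [hc] at this

theorem chi_zero : chi K P 0 = 1 := rfl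

theorem chi_add (a b : P) : chi K P (a + b) = chi K P a * chi K P b := by
  apply Subtype.ext
  simp [chi_coe, AddMonoidAlgebra.single_mul_single]

/-- The isomorphism of the monoid algebra of `P` with the coordinate algebra. -/
def monoidAlgebraEquiv (K : Type*) [Field K] {n : ℕ} (P : AddSubmonoid (Fin n → ℤ)) :
    AddMonoidAlgebra K P ≃ₐ[K] coordRing K P :=
  AlgEquiv.ofBijective
    (AddMonoidAlgebra.lift K (coordRing K P) P
      { toFun := fun m => chi K P m.toAdd
        map_one' := chi_zero
        map_mul' := fun a b => chi_add a.toAdd b.toAdd })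
    (by
      -- Inside `K[T]` the lift is pushforward along `P → M`, so bijectivity becomes a statement
      -- about supports.
      have hmap : ∀ f : AddMonoidAlgebra K P,
          ((AddMonoidAlgebra.lift K (coordRing K P) P
            { toFun := fun m => chi K P m.toAdd
              map_one' := chi_zero
              map_mul' := fun a b => chi_add a.toAdd b.toAdd } f :
            coordRing K P) : AddMonoidAlgebra K (Fin n → ℤ)) =
          AddMonoidAlgebra.mapDomain ((↑) : P → Fin n → ℤ) f := by
        intro f
        induction f using AddMonoidAlgebra.induction_linear with
        | zero => simp
        | add f g hf hg => rw [map_add, AddMonoidAlgebra.mapDomain_add, ← hf, ← hg]; rfl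
        | single m r => simp [chi_coe]
      constructor
      · intro f g hfg
        apply AddMonoidAlgebra.mapDomain_injective (R := K) (Subtype.val_injective (p := (· ∈ P)))
        rw [← hmap, ← hmap, hfg]
      · intro f
        refine ⟨AddMonoidAlgebra.comapDomain (↑) Subtype.val_injective f.1, Subtype.ext ?_⟩
        rw [hmap, AddMonoidAlgebra.mapDomain_comapDomain]
        intro m hm
        rw [Subtype.range_coe]
        by_contra hmP
        exact (Finsupp.mem_support_iff.1 hm) (mem_coordRing.1 f.2 m hmP))

theorem monoidAlgebraEquiv_single (m : P) (c : K) :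
    monoidAlgebraEquiv K P (AddMonoidAlgebra.single m c) = c • chi K P m :=
  AddMonoidAlgebra.lift_single _ _ _

theorem coordRing_induction {p : coordRing K P → Prop} (f : coordRing K P)
    (hzero : p 0) (hadd : ∀ f g, p f → p g → p (f + g)) (hsmul : ∀ (c : K) m, p (c • chi K P m)) :
    p f := by
  obtain ⟨f, rfl⟩ := (monoidAlgebraEquiv K P).surjective f
  induction f using AddMonoidAlgebra.induction_linear with
  | zero => simpa using hzero
  | add f g hf hg => rw [map_add]; exact hadd _ _ hf hg
  | single m c => rw [monoidAlgebraEquiv_single]; exact hsmul c m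

/-- The algebra homomorphism on `K[X]` determined by its values on characters. -/
def coordLift {B : Type*} [CommRing B] [Algebra K B] (F : Multiplicative P →* B) :
    coordRing K P →ₐ[K] B :=
  (AddMonoidAlgebra.lift K B P F).comp (monoidAlgebraEquiv K P).symm.toAlgHom

theorem coordLift_chi {B : Type*} [CommRing B] [Algebra K B] (F : Multiplicative P →* B) (m : P) :
    coordLift F (chi K P m) = F (Multiplicative.ofAdd m) := by
  have : (monoidAlgebraEquiv K P).symm (chi K P m) = AddMonoidAlgebra.single m 1 := by
    rw [AlgEquiv.symm_apply_eq, monoidAlgebraEquiv_single, one_smul]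
  simp [coordLift, this]

theorem coordRing_algHom_ext {B : Type*} [CommRing B] [Algebra K B]
    {f g : coordRing K P →ₐ[K] B} (h : ∀ m, f (chi K P m) = g (chi K P m)) : f = g := by
  ext x
  refine coordRing_induction (p := fun x => f x = g x) x (by simp) (fun x y hx hy => ?_) fun c m => ?_
  · rw [map_add, map_add, hx, hy]
  · rw [map_smul, map_smul, h]

theorem coordRing_eq_sum (f : coordRing K P) :
    ∃ s : P →₀ K, f = s.sum fun m c => c • chi K P m := by
  refine coordRing_induction
    (p := fun f => ∃ s : P →₀ K, f = s.sum fun m c => c • chi K P m) f ⟨0, by simp⟩ ?_ ?_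
  · rintro _ _ ⟨s, rfl⟩ ⟨t, rfl⟩
    refine ⟨s + t, ?_⟩
    rw [Finsupp.sum_add_index' (by simp) (by intros; rw [add_smul])]
  · intro c m
    exact ⟨Finsupp.single m c, by simp⟩

/-! ### The derivation attached to a root -/

/-- The linear operator `χ^m ↦ ⟨m, v⟩ χ^{m+e}` on `K[T]`. -/
def rootOperator (K : Type*) [Field K] {n : ℕ} (v e : Fin n → ℤ) :
    AddMonoidAlgebra K (Fin n → ℤ) →ₗ[K] AddMonoidAlgebra K (Fin n → ℤ) :=
  (Finsupp.lsum K fun m : Fin n → ℤ =>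
    ((m ⬝ᵥ v : ℤ) : K) • (LinearMap.toSpanSingleton K (AddMonoidAlgebra K (Fin n → ℤ))
      (AddMonoidAlgebra.single (m + e) 1))) ∘ₗ
    (AddMonoidAlgebra.coeffLinearEquiv K).toLinearMap

theorem rootOperator_single (e m : Fin n → ℤ) (c : K) :
    rootOperator K v e (AddMonoidAlgebra.single m c) =
      AddMonoidAlgebra.single (m + e) (((m ⬝ᵥ v : ℤ) : K) * c) := by
  simp [rootOperator, AddMonoidAlgebra.smul_single]

theorem rootOperator_mul (e : Fin n → ℤ) (f g : AddMonoidAlgebra K (Fin n → ℤ)) :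
    rootOperator K v e (f * g) = f * rootOperator K v e g + g * rootOperator K v e f := by
  induction f using AddMonoidAlgebra.induction_linear with
  | zero => simp
  | add f₁ f₂ h₁ h₂ => rw [add_mul, map_add, h₁, h₂, map_add]; ring
  | single a r =>
    induction g using AddMonoidAlgebra.induction_linear with
    | zero => simp
    | add f₁ f₂ h₁ h₂ => rw [mul_add, map_add, h₁, h₂, map_add]; ring
    | single b s =>
      simp only [AddMonoidAlgebra.single_mul_single, rootOperator_single]
      rw [← add_assoc a b e, ← add_assoc b a e, add_comm b a, ← AddMonoidAlgebra.single_add,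
        add_dotProduct]
      congr 1
      push_cast
      ring

/-- Characters on the facet have coefficient zero, so it does not matter that `m + e` leaves `P`
there. -/
theorem rootOperator_mem {e : Fin n → ℤ} (hv : ∀ m ∈ P, 0 ≤ m ⬝ᵥ v)
    (he : ∀ m ∈ P, 0 < m ⬝ᵥ v → m + e ∈ P)
    (f : coordRing K P) : rootOperator K v e f ∈ coordRing K P := by
  refine coordRing_induction (p := fun f => rootOperator K v e f.1 ∈ coordRing K P) f
    ?_ (fun f g hf hg => ?_) fun c m => ?_
  · rw [ZeroMemClass.coe_zero, map_zero]
    exact zero_mem _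
  · rw [Subalgebra.coe_add, map_add]
    exact add_mem hf hg
  · rw [Subalgebra.coe_smul, map_smul, chi_coe, rootOperator_single]
    refine Subalgebra.smul_mem _ ?_ _
    rcases (hv m m.2).eq_or_lt with h | h
    · rw [← h]
      simp
    · exact single_mem_coordRing (he m m.2 h) _

/-- Leibniz comes from additivity of the height. Each application lowers the height by one and kills
height zero, so `χ^m` dies after `⟨m, v⟩ + 1` steps. -/
theorem demazureLNDWellDefined_of_root (K : Type*) [Field K] {e : Fin n → ℤ}
    (hv : ∀ m ∈ P, 0 ≤ m ⬝ᵥ v) (hev : e ⬝ᵥ v = -1) (he : ∀ m ∈ P, 0 < m ⬝ᵥ v → m + e ∈ P) :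
    DemazureLNDWellDefined K P v e := by
  let L : coordRing K P →ₗ[K] coordRing K P :=
    ((rootOperator K v e).comp (coordRing K P).val.toLinearMap).codRestrict
      (Subalgebra.toSubmodule (coordRing K P)) (rootOperator_mem hv he)
  have hL : ∀ f, (L f : AddMonoidAlgebra K (Fin n → ℤ)) = rootOperator K v e f := fun _ => rfl
  refine ⟨Derivation.mk' L fun f g => Subtype.ext ?_, fun m => ?_, ?_⟩
  · simp only [hL, Subalgebra.coe_mul, rootOperator_mul, smul_eq_mul, Subalgebra.coe_add]
  · rw [Derivation.coe_mk', hL, chi_coe, rootOperator_single, mul_one]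
  · rw [Derivation.coe_mk']
    have hchi : ∀ (k : ℕ) (m : P), (m : Fin n → ℤ) ⬝ᵥ v < k → (L ^ k) (chi K P m) = 0 := by
      intro k
      induction k with
      | zero => intro m hm; exact absurd (hv m m.2) (by simpa using hm)
      | succ k ih =>
        intro m hm
        rw [pow_succ, Module.End.mul_apply]
        rcases (hv m m.2).eq_or_lt with h | h
        · have : L (chi K P m) = 0 := Subtype.ext (by
            rw [hL, chi_coe, rootOperator_single, ← h]
            simp)
          rw [this, map_zero]
        · have : L (chi K P m) =
              (((m : Fin n → ℤ) ⬝ᵥ v : ℤ) : K) • chi K P ⟨m + e, he m m.2 h⟩ := Subtype.ext (by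
            rw [hL, chi_coe, rootOperator_single, Subalgebra.coe_smul, chi_coe,
              AddMonoidAlgebra.smul_single, smul_eq_mul])
          rw [this, map_smul, ih _ (by
            push_cast at hm ⊢
            rw [add_dotProduct, hev]
            omega), smul_zero]
    intro f
    suffices h : ∃ k : ℕ, (L ^ k) f = 0 by
      obtain ⟨k, hk⟩ := h
      exact ⟨k, by rw [← Module.End.coe_pow, hk]⟩
    refine coordRing_induction (p := fun f => ∃ k : ℕ, (L ^ k) f = 0) f ⟨0, by simp⟩ ?_ ?_
    · rintro f g ⟨k, hk⟩ ⟨l, hl⟩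
      refine ⟨k + l, ?_⟩
      rw [map_add]
      nth_rewrite 1 [add_comm k l]
      rw [pow_add, pow_add, Module.End.mul_apply, Module.End.mul_apply, hk, hl, map_zero,
        map_zero, add_zero]
    · intro c m
      obtain ⟨k, hk⟩ := Int.eq_ofNat_of_zero_le (hv m m.2)
      exact ⟨k + 1, by rw [map_smul, hchi _ _ (by rw [hk]; push_cast; omega), smul_zero]⟩

/-- In characteristic zero the coefficient `⟨m, v⟩` is nonzero, so `χ^{m+e}` itself must be regular.
-/
theorem DemazureLNDWellDefined.add_mem [CharZero K] {e : Fin n → ℤ}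
    (h : DemazureLNDWellDefined K P v e) : ∀ m ∈ P, 0 < m ⬝ᵥ v → m + e ∈ P := by
  obtain ⟨δ, hδ, -⟩ := h
  intro m hm hmv
  refine mem_of_single_mem_coordRing (K := K) (c := ((m ⬝ᵥ v : ℤ) : K))
    (by exact_mod_cast hmv.ne') ?_
  rw [← hδ ⟨m, hm⟩]
  exact (δ (chi K P ⟨m, hm⟩)).2

theorem exists_demazureRoot_iff (K : Type*) [Field K] [CharZero K] (hfg : P.FG)
    (hgen : AddSubgroup.closure (P : Set (Fin n → ℤ)) = ⊤)
    {ρ : PointedCone ℚ (Fin n → ℚ)} (hρ : IsExtremalRay ρ (fanCone P))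
    (hvρ : IsPrimitiveVectorOn ρ v) (hv : IsFacetNormal P v) :
    (∃ e ∈ demazureRoots P ρ, DemazureLNDWellDefined K P v e) ↔ IsLocallyHalfSpace P v := by
  constructor
  · rintro ⟨e, ⟨⟨w, hw, hew⟩, -⟩, hδ⟩
    obtain rfl := hvρ.eq hgen hρ hw hew
    exact hv.isLocallyHalfSpace_of_root hgen hew hδ.add_mem
  · intro hloc
    obtain ⟨e, hev, he⟩ := hloc.exists_root hfg hv hvρ.2.2
    exact ⟨e, mem_demazureRoots hfg hgen hρ hvρ hev he,
      demazureLNDWellDefined_of_root K hv.nonneg hev he⟩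

end

/-! ### Characters of the torus -/

section

variable {K : Type*} [Field K] {n : ℕ}

theorem charEval_add (a b : Fin n → ℤ) (t : Fin n → Kˣ) :
    charEval (a + b) t = charEval a t * charEval b t := by
  simp [charEval, zpow_add, Finset.prod_mul_distrib]

theorem charEval_zero (t : Fin n → Kˣ) : charEval (0 : Fin n → ℤ) t = 1 := by
  simp [charEval]

theorem charEval_one (m : Fin n → ℤ) : charEval m (1 : Fin n → Kˣ) = 1 := by
  simp [charEval]

/-- The character of weight `m` as a `K`-valued multiplicative function on the torus. -/
def charHom (K : Type*) [Field K] {n : ℕ} (m : Fin n → ℤ) : (Fin n → Kˣ) →* K where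
  toFun t := charEval m t
  map_one' := by rw [charEval_one, Units.val_one]
  map_mul' s t := by simp [charEval, mul_zpow, Finset.prod_mul_distrib]

theorem charHom_injective [CharZero K] : Function.Injective (charHom K (n := n)) := by
  intro a b hab
  ext i
  have h2 : (2 : K) ≠ 0 := two_ne_zero
  have h := DFunLike.congr_fun hab (Pi.mulSingle i (Units.mk0 2 h2))
  have heval : ∀ m : Fin n → ℤ,
      charHom K m (Pi.mulSingle i (Units.mk0 2 h2)) = (2 : K) ^ m i := by
    intro m
    change ((∏ j, (Pi.mulSingle i (Units.mk0 2 h2) : Fin n → Kˣ) j ^ m j : Kˣ) : K) = _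
    rw [Finset.prod_eq_single i]
    · simp
    · intro j _ hj
      simp [hj]
    · simp
  rw [heval, heval] at h
  have h' : (2 : ℚ) ^ a i = (2 : ℚ) ^ b i := by
    have : (((2 : ℚ) ^ a i : ℚ) : K) = (((2 : ℚ) ^ b i : ℚ) : K) := by
      push_cast
      exact h
    exact_mod_cast this
  exact zpow_right_injective₀ (by norm_num) (by norm_num) h'

/-- Dedekind's independence of characters; they are distinct because powers of `2` are distinct in
characteristic zero. -/
theorem linearIndependent_charEval [CharZero K] :
    LinearIndependent K fun (m : Fin n → ℤ) (t : Fin n → Kˣ) => (charEval m t : K) :=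
  (linearIndependent_monoidHom (Fin n → Kˣ) K).comp (charHom K) charHom_injective

/-- A homomorphism from a monoid of lattice points to the units of an algebraically closed field
is the evaluation at a point of the torus. -/
theorem exists_charEval_eq [IsAlgClosed K] (Q : AddSubmonoid (Fin n → ℤ))
    (f : Multiplicative Q →* Kˣ) :
    ∃ t : Fin n → Kˣ, ∀ q : Q, charEval (q : Fin n → ℤ) t = f (Multiplicative.ofAdd q) := by
  -- The group generated by `Q`; the homomorphism extends to it by quotients.
  let D : AddSubgroup (Fin n → ℤ) :=
    { carrier := {m | ∃ a b : Q, m + b = a}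
      zero_mem' := ⟨0, 0, by simp⟩
      add_mem' := by
        rintro x y ⟨a, b, h⟩ ⟨c, d, h'⟩
        exact ⟨a + c, b + d, by push_cast; rw [← h, ← h']; abel⟩
      neg_mem' := by
        rintro x ⟨a, b, h⟩
        exact ⟨b, a, by rw [← h]; abel⟩ }
  have hD : ∀ m : D, ∃ a b : Q, (m : Fin n → ℤ) + b = a := fun m => m.2
  choose num den hnd using hD
  have key : ∀ a b c d : Q, a + d = c + b →
      f (.ofAdd a) / f (.ofAdd b) = f (.ofAdd c) / f (.ofAdd d) := by
    intro a b c d h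
    rw [div_eq_div_iff_mul_eq_mul, ← f.map_mul, ← f.map_mul, ← ofAdd_add, ← ofAdd_add, h]
  let g : D →+ Additive Kˣ := AddMonoidHom.mk'
    (fun m => Additive.ofMul (f (.ofAdd (num m)) / f (.ofAdd (den m)))) (by
      intro x y
      rw [← ofMul_mul]
      congr 1
      rw [div_mul_div_comm, ← f.map_mul, ← f.map_mul, ← ofAdd_add, ← ofAdd_add]
      refine key _ _ _ _ (Subtype.ext ?_)
      push_cast
      rw [← hnd, ← hnd, ← hnd]
      push_cast
      abel)
  -- Roots exist in `K`, so `Kˣ` is divisible, hence an injective abelian group, and the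
  -- homomorphism extends from `D` to the whole lattice.
  let _ : DivisibleBy (Additive Kˣ) ℕ := divisibleByOfSMulRightSurj _ _ fun {k} hk x => by
    obtain ⟨z, hz⟩ := IsAlgClosed.exists_pow_nat_eq ((Additive.toMul x : Kˣ) : K)
      (Nat.pos_of_ne_zero hk)
    have hz0 : z ≠ 0 := by
      rintro rfl
      rw [zero_pow hk] at hz
      exact (Additive.toMul x).ne_zero hz.symm
    refine ⟨Additive.ofMul (Units.mk0 z hz0), ?_⟩
    change Additive.ofMul (Units.mk0 z hz0 ^ k) = x
    rw [← ofMul_toMul x]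
    congr 1
    ext
    simpa using hz
  let _ : DivisibleBy (Additive Kˣ) ℤ := AddGroup.divisibleByIntOfDivisibleByNat _
  obtain ⟨φ, hφ⟩ := (Module.Baer.of_divisible (Additive Kˣ)).extension_property_addMonoidHom
    D.subtype Subtype.val_injective g
  refine ⟨fun i => Additive.toMul (φ (Pi.single i 1)), fun q => ?_⟩
  have h1 : charEval (q : Fin n → ℤ) (fun i => Additive.toMul (φ (Pi.single i 1))) =
      Additive.toMul (φ q) := by
    conv_rhs => rw [← Finset.univ_sum_single (q : Fin n → ℤ), map_sum, toMul_sum]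
    refine Finset.prod_congr rfl fun i _ => ?_
    rw [← toMul_zsmul, ← map_zsmul, ← Pi.single_smul, smul_eq_mul, mul_one]
  rw [h1]
  have h2 : φ q = g ⟨q, q, 0, by simp⟩ := (DFunLike.congr_fun hφ ⟨q, q, 0, by simp⟩)
  rw [h2]
  change f _ / f _ = _
  rw [key _ _ q 0 (Subtype.ext (by
    push_cast
    rw [← hnd]
    simp)), ofAdd_zero, map_one, div_one]

end

/-! ### The orbit of a facet -/

section

variable {K : Type*} [Field K] {n : ℕ} {P : AddSubmonoid (Fin n → ℤ)} {v : Fin n → ℤ}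

theorem mem_zeroSet_faceIdeal_iff {τ : PointedCone ℚ (Fin n → ℚ)}
    (hτ : ∀ m ∈ P, latticeVec m ∈ τ ↔ m ⬝ᵥ v = 0) {x : Point K P} :
    x ∈ zeroSet (faceIdeal K P τ : Set (coordRing K P)) ↔
      ∀ m : P, (m : Fin n → ℤ) ⬝ᵥ v ≠ 0 → x (chi K P m) = 0 := by
  constructor
  · intro h m hm
    exact h _ (Ideal.subset_span ⟨m, fun hmτ => hm ((hτ m m.2).1 hmτ), rfl⟩)
  · intro h f hf
    have : faceIdeal K P τ ≤ RingHom.ker x := by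
      refine Ideal.span_le.2 ?_
      rintro _ ⟨m, hm, rfl⟩
      exact h m fun hmv => hm ((hτ m m.2).2 hmv)
    exact this hf

/-- The translate by `t` of the distinguished point of the orbit of a facet: the point where
`χ^m` takes the value `χ^m(t)` for `m` on the facet and vanishes for the other `m ∈ P`. -/
def facetPoint {K : Type*} [Field K] {n : ℕ} {P : AddSubmonoid (Fin n → ℤ)} {v : Fin n → ℤ}
    (hv : IsFacetNormal P v) (t : Fin n → Kˣ) : Point K P :=
  coordLift
    { toFun := fun m => if (m.toAdd : Fin n → ℤ) ⬝ᵥ v = 0 then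
        (charEval (m.toAdd : Fin n → ℤ) t : K) else 0
      map_one' := by simp [charEval_zero]
      map_mul' := fun a b => by
        have ha := hv.nonneg _ a.toAdd.2
        have hb := hv.nonneg _ b.toAdd.2
        rw [toAdd_mul, AddSubmonoid.coe_add, add_dotProduct, charEval_add]
        by_cases h1 : (a.toAdd : Fin n → ℤ) ⬝ᵥ v = 0
        · by_cases h2 : (b.toAdd : Fin n → ℤ) ⬝ᵥ v = 0
          · simp [h1, h2]
          · simp [h1, h2]
        · rw [if_neg h1, if_neg (by omega), zero_mul] }

theorem facetPoint_chi (hv : IsFacetNormal P v) (t : Fin n → Kˣ) (m : P) :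
    facetPoint hv t (chi K P m) =
      if (m : Fin n → ℤ) ⬝ᵥ v = 0 then (charEval (m : Fin n → ℤ) t : K) else 0 :=
  coordLift_chi _ _

theorem facetPoint_mem_zeroSet (hv : IsFacetNormal P v) {τ : PointedCone ℚ (Fin n → ℚ)}
    (hτ : ∀ m ∈ P, latticeVec m ∈ τ ↔ m ⬝ᵥ v = 0) (t : Fin n → Kˣ) :
    facetPoint hv t ∈ zeroSet (faceIdeal K P τ : Set (coordRing K P)) := by
  rw [mem_zeroSet_faceIdeal_iff hτ]
  intro m hm
  rw [facetPoint_chi, if_neg hm]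

/-- Heights are nonnegative on `P`, so a sum on the facet has both summands there: `F` is generated
by the generators it contains. -/
theorem apply_chi_ne_zero_of_sum {G : Finset (Fin n → ℤ)}
    (hG : AddSubmonoid.closure (G : Set (Fin n → ℤ)) = P) (hv : IsFacetNormal P v)
    {y : Point K P} (hy : ∀ (g : Fin n → ℤ) (hg : g ∈ P), g ∈ G → g ⬝ᵥ v = 0 →
      y (chi K P ⟨g, hg⟩) ≠ 0) :
    ∀ (m : Fin n → ℤ) (hm : m ∈ P), m ⬝ᵥ v = 0 → y (chi K P ⟨m, hm⟩) ≠ 0 := by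
  intro m hm
  have hm' := hm
  rw [← hG] at hm'
  induction hm' using AddSubmonoid.closure_induction with
  | mem x hx => exact hy x hm hx
  | zero =>
    intro _ h
    have : chi K P ⟨0, hm⟩ = 1 := chi_zero
    rw [this, map_one] at h
    exact one_ne_zero h
  | add a b ha hb iha ihb =>
    intro hab
    rw [hG] at ha hb
    rw [add_dotProduct] at hab
    have h1 := hv.nonneg a ha
    have h2 := hv.nonneg b hb
    have : chi K P ⟨a + b, hm⟩ = chi K P ⟨a, ha⟩ * chi K P ⟨b, hb⟩ := chi_add ⟨a, ha⟩ ⟨b, hb⟩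
    rw [this, map_mul]
    exact mul_ne_zero (iha ha (by omega)) (ihb hb (by omega))

theorem facetPoint_one_mem_faceOrbit [IsAlgClosed K] (hfg : P.FG) (hv : IsFacetNormal P v)
    {τ : PointedCone ℚ (Fin n → ℚ)} (hτ : ∀ m ∈ P, latticeVec m ∈ τ ↔ m ⬝ᵥ v = 0) :
    facetPoint hv (1 : Fin n → Kˣ) ∈ faceOrbit K P τ := by
  obtain ⟨G, hG⟩ := hfg
  have hGP : ∀ g ∈ G, g ∈ P := fun g hg => hG ▸ AddSubmonoid.subset_closure hg
  classical
  -- The sum of all generators on the facet: `χ^p ≠ 0` forces every face character to be nonzero, so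
  -- the orbit is the locus `χ^p ≠ 0` in the zero set.
  let p : P := ⟨∑ g ∈ G with g ⬝ᵥ v = 0, g, sum_mem fun g hg =>
    hGP g (Finset.mem_filter.1 hg).1⟩
  have hp : (p : Fin n → ℤ) ⬝ᵥ v = 0 := by
    rw [sum_dotProduct]
    exact Finset.sum_eq_zero fun g hg => (Finset.mem_filter.1 hg).2
  refine ⟨{chi K P p}, Set.ext fun y => ⟨?_, ?_⟩⟩
  · rintro ⟨t, ht⟩
    refine ⟨(mem_zeroSet_faceIdeal_iff hτ).2 fun m hm => ?_, fun h => ?_⟩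
    · rw [ht, facetPoint_chi, if_neg hm, mul_zero]
    · have h := h _ rfl
      rw [ht, facetPoint_chi, if_pos hp, charEval_one, Units.val_one, mul_one] at h
      exact Units.ne_zero _ h
  · rintro ⟨hyZ, hyp⟩
    rw [mem_zeroSet_faceIdeal_iff hτ] at hyZ
    have hyp : y (chi K P p) ≠ 0 := fun h => hyp (by
      rintro _ rfl
      exact h)
    have hne := apply_chi_ne_zero_of_sum hG hv (y := y) (fun g hg hgG hgv h => by
      apply hyp
      have hgf : g ∈ G.filter (· ⬝ᵥ v = 0) := Finset.mem_filter.2 ⟨hgG, hgv⟩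
      have : p = ⟨g, hg⟩ + ⟨∑ g ∈ (G.filter (· ⬝ᵥ v = 0)).erase g, g, sum_mem fun x hx =>
          hGP x (Finset.mem_filter.1 (Finset.mem_of_mem_erase hx)).1⟩ :=
        Subtype.ext (Finset.add_sum_erase _ (fun g => g) hgf).symm
      rw [this, chi_add, map_mul, h, zero_mul])
    let f : Multiplicative (faceMonoid P v) →* Kˣ :=
      { toFun := fun q => Units.mk0 (y (chi K P ⟨q.toAdd, q.toAdd.2.1⟩))
          (hne _ q.toAdd.2.1 q.toAdd.2.2)
        map_one' := Units.ext (by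
          change y 1 = 1
          exact map_one y)
        map_mul' := fun a b => Units.ext (by
          change y (chi K P (⟨a.toAdd, a.toAdd.2.1⟩ + ⟨b.toAdd, b.toAdd.2.1⟩)) = _
          rw [chi_add, map_mul]
          rfl) }
    obtain ⟨t, ht⟩ := exists_charEval_eq (faceMonoid P v) f
    refine ⟨t, fun m => ?_⟩
    rw [facetPoint_chi]
    split_ifs with hm
    · rw [charEval_one, Units.val_one, mul_one, ht ⟨m, m.2, hm⟩]
      rfl
    · rw [mul_zero, hyZ m hm]

/-- Openness of the orbit of `x` provides a function nonzero at `x`, and only its terms on the facet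
contribute there. Such a function is nonzero at some `facetPoint hv t`, which therefore lies in the
orbit of `x`; face characters vanish nowhere on the orbit of that point. -/
theorem apply_chi_ne_zero_of_mem_faceOrbit [CharZero K] (hv : IsFacetNormal P v)
    {τ : PointedCone ℚ (Fin n → ℚ)} (hτ : ∀ m ∈ P, latticeVec m ∈ τ ↔ m ⬝ᵥ v = 0)
    {x : Point K P} (hx : x ∈ faceOrbit K P τ) {q : P} (hq : (q : Fin n → ℤ) ⬝ᵥ v = 0) :
    x (chi K P q) ≠ 0 := by
  obtain ⟨S, hS⟩ := hx
  have hxx : x ∈ torusOrbit x := ⟨1, fun m => by rw [charEval_one, Units.val_one, one_mul]⟩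
  rw [hS] at hxx
  obtain ⟨hxZ, hxS⟩ := hxx
  rw [mem_zeroSet_faceIdeal_iff hτ] at hxZ
  have hxS : ∃ s ∈ S, x s ≠ 0 := by
    by_contra! h
    exact hxS h
  obtain ⟨s, hs, hxs⟩ := hxS
  obtain ⟨c, rfl⟩ := coordRing_eq_sum s
  have hsum : ∀ y : Point K P, y (c.sum fun m a => a • chi K P m) =
      ∑ m ∈ c.support, c m * y (chi K P m) := by
    intro y
    rw [Finsupp.sum, map_sum]
    exact Finset.sum_congr rfl fun m _ => by rw [map_smul, smul_eq_mul]
  rw [hsum] at hxs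
  obtain ⟨m₀, hm₀, hcm₀⟩ := Finset.exists_ne_zero_of_sum_ne_zero hxs
  have hm₀v : (m₀ : Fin n → ℤ) ⬝ᵥ v = 0 := by
    by_contra h
    exact hcm₀ (by rw [hxZ m₀ h, mul_zero])
  by_cases h : ∃ t : Fin n → Kˣ, facetPoint hv t (c.sum fun m a => a • chi K P m) ≠ 0
  · obtain ⟨t, ht⟩ := h
    have hmem : facetPoint hv t ∈ torusOrbit x := by
      rw [hS]
      exact ⟨facetPoint_mem_zeroSet hv hτ t, fun h => ht (h _ hs)⟩
    obtain ⟨t', ht'⟩ := hmem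
    have h1 := ht' q
    rw [facetPoint_chi, if_pos hq] at h1
    intro h0
    rw [h0, mul_zero] at h1
    exact Units.ne_zero _ h1
  · push Not at h
    -- Vanishing at all `facetPoint hv t` is a linear relation among distinct torus characters,
    -- contradicting the nonzero coefficient at `m₀`.
    exfalso
    have hli := (linearIndependent_charEval (K := K) (n := n)).comp ((↑) : P → Fin n → ℤ)
      Subtype.val_injective
    rw [linearIndependent_iff'] at hli
    classical
    have := hli (c.support.filter fun m : P => (m : Fin n → ℤ) ⬝ᵥ v = 0) c (by
      funext t
      have ht := h t
      rw [hsum] at ht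
      rw [Finset.sum_apply, Finset.sum_filter, Pi.zero_apply]
      refine Eq.trans (Finset.sum_congr rfl fun m _ => ?_) ht
      rw [facetPoint_chi]
      split_ifs
      · rfl
      · rw [mul_zero]) m₀ (Finset.mem_filter.2 ⟨hm₀, hm₀v⟩)
    exact Finsupp.mem_support_iff.1 hm₀ this

end

/-! ### Tangent vectors at smooth points lift to higher order -/

section

variable {K : Type*} [Field K] {n : ℕ} {P : AddSubmonoid (Fin n → ℤ)} {v : Fin n → ℤ}

theorem exists_lift_of_formallySmooth_localization {R A L B C : Type*} [CommRing R] [CommRing A]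
    [CommRing L] [CommRing B] [CommRing C] [Algebra R A] [Algebra R L] [Algebra A L]
    [IsScalarTower R A L] [Algebra R B] [Algebra R C] (M : Submonoid A) [IsLocalization M L]
    [Algebra.FormallySmooth R L] (φ : A →ₐ[R] C) (hφ : ∀ y : M, IsUnit (φ y)) (g : B →ₐ[R] C)
    (hg : Function.Surjective g) (hnil : IsNilpotent (RingHom.ker (g : B →+* C))) :
    ∃ ψ : A →ₐ[R] B, ∀ f, g (ψ f) = φ f := by
  let φ' : L →ₐ[R] C := IsLocalization.liftAlgHom (M := M) (f := φ) hφ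
  refine ⟨(Algebra.FormallySmooth.liftOfSurjective φ' g hg hnil).comp
    (IsScalarTower.toAlgHom R A L), fun f => ?_⟩
  exact (Algebra.FormallySmooth.liftOfSurjective_apply φ' g hg hnil _).trans
    (IsLocalization.lift_eq hφ f)

/-- A dual number is a unit as soon as its constant part is, so a tangent vector at `x` extends to
the local ring, where formal smoothness applies. -/
theorem IsSmoothPoint.exists_lift {x : Point K P} (hx : IsSmoothPoint x) {B : Type*} [CommRing B]
    [Algebra K B] (φ : coordRing K P →ₐ[K] DualNumber K)
    (hφ : ∀ f, TrivSqZeroExt.fst (φ f) = x f)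
    (g : B →ₐ[K] DualNumber K) (hg : Function.Surjective g)
    (hnil : IsNilpotent (RingHom.ker (g : B →+* DualNumber K))) :
    ∃ ψ : coordRing K P →ₐ[K] B, ∀ f, g (ψ f) = φ f := by
  have : (RingHom.ker x).IsPrime := RingHom.ker_isPrime x
  have : Algebra.FormallySmooth K (Localization.AtPrime (RingHom.ker x)) := hx
  refine exists_lift_of_formallySmooth_localization (L := Localization.AtPrime (RingHom.ker x))
    (RingHom.ker x).primeCompl φ (fun y => ?_) g hg hnil
  rw [TrivSqZeroExt.isUnit_iff_isUnit_fst, hφ]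
  exact isUnit_iff_ne_zero.2 y.2

theorem aeval_eps_eq_zero {p : Polynomial K}
    (hp : Polynomial.aeval (DualNumber.eps : DualNumber K) p = 0) : Polynomial.X ^ 2 ∣ p := by
  have hdec : p = Polynomial.X ^ 2 * p.divX.divX + Polynomial.C (p.coeff 1) * Polynomial.X +
      Polynomial.C (p.coeff 0) := by
    conv_lhs => rw [← Polynomial.divX_mul_X_add p, ← Polynomial.divX_mul_X_add p.divX,
      Polynomial.coeff_divX]
    ring
  have h : Polynomial.aeval (DualNumber.eps : DualNumber K) p =
      algebraMap K (DualNumber K) (p.coeff 1) * DualNumber.eps +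
        algebraMap K (DualNumber K) (p.coeff 0) := by
    conv_lhs => rw [hdec]
    simp [pow_two]
  rw [h] at hp
  have h0 := congrArg TrivSqZeroExt.fst hp
  have h1 := congrArg TrivSqZeroExt.snd hp
  simp [TrivSqZeroExt.algebraMap_eq_inl] at h0 h1
  rw [Polynomial.X_pow_dvd_iff]
  intro d hd
  interval_cases d
  · exact h0
  · exact h1

/-- At a smooth point, two functions `f₁`, `f₂` with a relation `f₁ ^ k₁ u₁ = f₂ ^ k₂ u₂`,
`0 < k₁ ≤ k₂`, cannot be such that some tangent vector vanishes on `f₂` but not on `f₁`. -/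
theorem IsSmoothPoint.not_exists_tangent {x : Point K P} (hx : IsSmoothPoint x)
    (φ : coordRing K P →ₐ[K] DualNumber K) (hφ : ∀ f, TrivSqZeroExt.fst (φ f) = x f)
    {f₁ f₂ u₁ u₂ : coordRing K P} {k₁ k₂ : ℕ} (hk₁ : 0 < k₁) (hk : k₁ ≤ k₂)
    (hrel : f₁ ^ k₁ * u₁ = f₂ ^ k₂ * u₂) (hf₁ : φ f₁ = DualNumber.eps) (hf₂ : φ f₂ = 0)
    (hu₁ : φ u₁ = 1) : False := by
  -- The truncation is the coarsest in which the `k₁`-th power of a lift of `ε` survives.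
  let I : Ideal (Polynomial K) := Ideal.span {Polynomial.X ^ (k₁ + 1)}
  let g : (Polynomial K ⧸ I) →ₐ[K] DualNumber K :=
    Ideal.Quotient.liftₐ I (Polynomial.aeval DualNumber.eps) (by
      intro a ha
      obtain ⟨b, rfl⟩ := Ideal.mem_span_singleton.1 ha
      obtain ⟨l, rfl⟩ := Nat.exists_eq_succ_of_ne_zero hk₁.ne'
      rw [map_mul, map_pow, Polynomial.aeval_X, pow_succ, pow_succ, mul_assoc (_ ^ l),
        DualNumber.eps_mul_eps, mul_zero, zero_mul])
  have hgmk : ∀ p, g (Ideal.Quotient.mk I p) = Polynomial.aeval DualNumber.eps p := fun p => rfl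
  have hker : ∀ p, g (Ideal.Quotient.mk I p) = 0 → Polynomial.X ^ 2 ∣ p := fun p hp =>
    aeval_eps_eq_zero hp
  have hsurj : Function.Surjective g := by
    intro z
    refine ⟨Ideal.Quotient.mk I (Polynomial.C z.fst + Polynomial.C z.snd * Polynomial.X), ?_⟩
    rw [hgmk]
    ext <;> simp [TrivSqZeroExt.algebraMap_eq_inl]
  have hnil : IsNilpotent (RingHom.ker (g : (Polynomial K ⧸ I) →+* DualNumber K)) := by
    refine ⟨k₁ + 1, ?_⟩
    have hle : RingHom.ker (g : (Polynomial K ⧸ I) →+* DualNumber K) ≤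
        Ideal.span {Ideal.Quotient.mk I Polynomial.X} := by
      intro b hb
      obtain ⟨p, rfl⟩ := Ideal.Quotient.mk_surjective b
      rw [Ideal.mem_span_singleton]
      exact map_dvd _ ((dvd_pow_self _ two_ne_zero).trans (hker p hb))
    refine le_bot_iff.1 ((Ideal.pow_right_mono hle _).trans ?_)
    rw [Ideal.span_singleton_pow, ← map_pow, Ideal.Quotient.eq_zero_iff_mem.2
      (Ideal.mem_span_singleton_self _)]
    simp
  obtain ⟨ψ, hψ⟩ := hx.exists_lift φ hφ g hsurj hnil
  obtain ⟨F₁, hF₁⟩ := Ideal.Quotient.mk_surjective (ψ f₁)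
  obtain ⟨F₂, hF₂⟩ := Ideal.Quotient.mk_surjective (ψ f₂)
  obtain ⟨U₁, hU₁⟩ := Ideal.Quotient.mk_surjective (ψ u₁)
  obtain ⟨U₂, hU₂⟩ := Ideal.Quotient.mk_surjective (ψ u₂)
  -- Modulo `X ^ 2` the lifts of `f₁`, `f₂`, `u₁` are `X`, `0` and `1`.
  have h1 : Polynomial.X ^ 2 ∣ F₁ - Polynomial.X := hker _ (by
    rw [map_sub, map_sub, hF₁, hψ, hf₁, hgmk, Polynomial.aeval_X, sub_self])
  have h2 : Polynomial.X ^ 2 ∣ F₂ := hker _ (by rw [hF₂, hψ, hf₂])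
  have h3 : Polynomial.X ^ 2 ∣ U₁ - 1 := hker _ (by
    rw [map_sub, map_sub, hU₁, hψ, hu₁, map_one, map_one, sub_self])
  have h4 : Polynomial.X ^ (k₁ + 1) ∣ F₁ ^ k₁ * U₁ - F₂ ^ k₂ * U₂ := by
    rw [← Ideal.mem_span_singleton, ← Ideal.Quotient.eq_zero_iff_mem]
    rw [map_sub, map_mul, map_mul, map_pow, map_pow, hF₁, hF₂, hU₁, hU₂, ← map_pow, ← map_pow,
      ← map_mul, ← map_mul, hrel, sub_self]
  have h5 : Polynomial.X ^ (k₁ + 1) ∣ F₂ ^ k₂ * U₂ := by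
    refine Dvd.dvd.mul_right ?_ _
    -- The right side has order at least `2 * k₂`, which exceeds `k₁` because `k₂ ≥ k₁ ≥ 1`; the
    -- left side has order exactly `k₁`.
    refine (pow_dvd_pow _ (show k₁ + 1 ≤ 2 * k₂ by omega)).trans ?_
    rw [pow_mul]
    exact pow_dvd_pow_of_dvd h2 k₂
  have h6 : Polynomial.X ^ (k₁ + 1) ∣ F₁ ^ k₁ * U₁ := (dvd_sub_left h5).1 h4
  obtain ⟨r, hr⟩ := h1
  obtain ⟨s, hs⟩ := h3
  have hF : F₁ = Polynomial.X * (1 + Polynomial.X * r) := by linear_combination hr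
  have hU : U₁ = 1 + Polynomial.X ^ 2 * s := by linear_combination hs
  rw [hF, hU, mul_pow, pow_succ, mul_assoc,
    mul_dvd_mul_iff_left (pow_ne_zero _ Polynomial.X_ne_zero), Polynomial.X_dvd_iff,
    Polynomial.coeff_zero_eq_eval_zero] at h6
  simp at h6

end

/-! ### Smooth facets are half-spaces locally -/

section

variable {K : Type*} [Field K] {n : ℕ} {P : AddSubmonoid (Fin n → ℤ)} {v : Fin n → ℤ}

/-- Lattice points are associated if they differ by a difference of two elements of
`P ∩ v^⊥`. -/
def FaceAssociated (P : AddSubmonoid (Fin n → ℤ)) (v m m' : Fin n → ℤ) : Prop :=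
  ∃ a ∈ faceMonoid P v, ∃ b ∈ faceMonoid P v, m + a = m' + b

theorem FaceAssociated.refl (m : Fin n → ℤ) : FaceAssociated P v m m :=
  ⟨0, zero_mem _, 0, zero_mem _, rfl⟩

theorem FaceAssociated.symm {m m' : Fin n → ℤ} (h : FaceAssociated P v m m') :
    FaceAssociated P v m' m := by
  obtain ⟨a, ha, b, hb, h⟩ := h
  exact ⟨b, hb, a, ha, h.symm⟩

theorem FaceAssociated.trans {m₁ m₂ m₃ : Fin n → ℤ} (h : FaceAssociated P v m₁ m₂)
    (h' : FaceAssociated P v m₂ m₃) : FaceAssociated P v m₁ m₃ := by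
  obtain ⟨a, ha, b, hb, h⟩ := h
  obtain ⟨c, hc, d, hd, h'⟩ := h'
  exact ⟨a + c, add_mem ha hc, b + d, add_mem hb hd, by
    rw [← add_assoc, h, add_right_comm, h', add_right_comm, add_assoc]⟩

theorem FaceAssociated.add {m₁ m₂ m₃ m₄ : Fin n → ℤ} (h : FaceAssociated P v m₁ m₂)
    (h' : FaceAssociated P v m₃ m₄) : FaceAssociated P v (m₁ + m₃) (m₂ + m₄) := by
  obtain ⟨a, ha, b, hb, h⟩ := h
  obtain ⟨c, hc, d, hd, h'⟩ := h'
  exact ⟨a + c, add_mem ha hc, b + d, add_mem hb hd, by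
    rw [add_add_add_comm, h, h', add_add_add_comm]⟩

theorem FaceAssociated.dotProduct_eq {m m' : Fin n → ℤ} (h : FaceAssociated P v m m') :
    m ⬝ᵥ v = m' ⬝ᵥ v := by
  obtain ⟨a, ha, b, hb, h⟩ := h
  have := congrArg (· ⬝ᵥ v) h
  simpa [add_dotProduct, ha.2, hb.2] using this

theorem faceAssociated_add_left {a : Fin n → ℤ} (ha : a ∈ faceMonoid P v) (m : Fin n → ℤ) :
    FaceAssociated P v (a + m) m :=
  ⟨0, zero_mem _, a, ha, by abel⟩

/-- An element of `P` off the facet is irreducible in the localization of `P` at the facet. -/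
def IsFaceIrreducible (P : AddSubmonoid (Fin n → ℤ)) (v c : Fin n → ℤ) : Prop :=
  c ∈ P ∧ 0 < c ⬝ᵥ v ∧ ∀ a ∈ P, ∀ b ∈ P, 0 < a ⬝ᵥ v → 0 < b ⬝ᵥ v → ¬FaceAssociated P v (a + b) c

open Classical in
/-- The tangent vector at the distinguished point of a facet in the direction of an irreducible
element `c`. -/
def facetTangent (K : Type*) [Field K] {n : ℕ} {P : AddSubmonoid (Fin n → ℤ)} {v : Fin n → ℤ}
    (hv : IsFacetNormal P v) {c : Fin n → ℤ} (hc : IsFaceIrreducible P v c) :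
    coordRing K P →ₐ[K] DualNumber K :=
  coordLift
    { toFun := fun m => if (m.toAdd : Fin n → ℤ) ⬝ᵥ v = 0 then 1 else
        if FaceAssociated P v (m.toAdd : Fin n → ℤ) c then DualNumber.eps else 0
      map_one' := by simp
      map_mul' := fun a b => by
        have ha := hv.nonneg _ a.toAdd.2
        have hb := hv.nonneg _ b.toAdd.2
        have hassoc : ∀ x y : P, (x : Fin n → ℤ) ⬝ᵥ v = 0 →
            (FaceAssociated P v (x + y : Fin n → ℤ) c ↔ FaceAssociated P v (y : Fin n → ℤ) c) := by
          intro x y hx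
          have := faceAssociated_add_left (P := P) (v := v) ⟨x.2, hx⟩ (y : Fin n → ℤ)
          exact ⟨this.symm.trans, this.trans⟩
        rw [toAdd_mul, AddSubmonoid.coe_add]
        by_cases h1 : (a.toAdd : Fin n → ℤ) ⬝ᵥ v = 0
        · rw [if_pos h1, one_mul, add_dotProduct, h1, zero_add, hassoc _ _ h1]
        · by_cases h2 : (b.toAdd : Fin n → ℤ) ⬝ᵥ v = 0
          · rw [if_pos h2, mul_one, add_comm, add_dotProduct, h2, zero_add, hassoc _ _ h2]
          -- Off the facet irreducibility of `c` sends the product to zero, in agreement with `ε * ε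
          -- = 0`.
          · rw [add_dotProduct, if_neg h1, if_neg h2, if_neg (by omega), if_neg (hc.2.2 _ a.toAdd.2 _
              b.toAdd.2 (by omega) (by omega))]
            split_ifs <;> simp }

open Classical in
theorem facetTangent_chi (hv : IsFacetNormal P v) {c : Fin n → ℤ}
    (hc : IsFaceIrreducible P v c) (m : P) :
    facetTangent K hv hc (chi K P m) = if (m : Fin n → ℤ) ⬝ᵥ v = 0 then 1 else
      if FaceAssociated P v (m : Fin n → ℤ) c then DualNumber.eps else 0 :=
  coordLift_chi _ _

theorem fst_facetTangent (hv : IsFacetNormal P v) {c : Fin n → ℤ}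
    (hc : IsFaceIrreducible P v c) (f : coordRing K P) :
    TrivSqZeroExt.fst (facetTangent K hv hc f) = facetPoint hv 1 f := by
  have : (TrivSqZeroExt.fstHom K K K).comp (facetTangent K hv hc) = facetPoint hv 1 := by
    refine coordRing_algHom_ext fun m => ?_
    rw [AlgHom.comp_apply, facetTangent_chi, facetPoint_chi, charEval_one]
    split_ifs <;> simp
  exact DFunLike.congr_fun this f

theorem chi_nsmul (k : ℕ) (m : P) : chi K P (k • m) = chi K P m ^ k := by
  induction k with
  | zero => rw [zero_smul, pow_zero, chi_zero]
  | succ k ih => rw [succ_nsmul, chi_add, ih, pow_succ]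

/-- At a smooth facet, irreducible elements are associated to the elements of `P` of smaller
height. -/
theorem IsSmoothPoint.faceAssociated (hv : IsFacetNormal P v)
    (hsm : IsSmoothPoint (facetPoint (K := K) hv 1)) {c d : Fin n → ℤ}
    (hc : IsFaceIrreducible P v c) (hd : d ∈ P) (hdv : 0 < d ⬝ᵥ v) (hdc : d ⬝ᵥ v ≤ c ⬝ᵥ v) :
    FaceAssociated P v d c := by
  by_contra hnot
  obtain ⟨k, hk, a, ha, b, hb, h⟩ := hv.exists_nsmul_eq_sub
    ((d ⬝ᵥ v) • c - (c ⬝ᵥ v) • d) (by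
      rw [sub_dotProduct, smul_dotProduct, smul_dotProduct, smul_eq_mul, smul_eq_mul, mul_comm,
        sub_self])
  obtain ⟨s, hs⟩ := Int.eq_ofNat_of_zero_le hdv.le
  obtain ⟨t, ht⟩ := Int.eq_ofNat_of_zero_le hc.2.1.le
  rw [hs, ht] at h
  have hs0 : 0 < s := by omega
  have hst : s ≤ t := by omega
  -- The identity `k s c + b = k t d + a` becomes a binomial relation. Its exponents satisfy `k s ≤
  -- k t` because `d` is no higher than `c`.
  refine hsm.not_exists_tangent (facetTangent K hv hc) (fst_facetTangent hv hc)
    (f₁ := chi K P ⟨c, hc.1⟩) (f₂ := chi K P ⟨d, hd⟩) (u₁ := chi K P ⟨b, hb.1⟩)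
    (u₂ := chi K P ⟨a, ha.1⟩) (k₁ := k * s) (k₂ := k * t) (Nat.mul_pos hk hs0)
    (Nat.mul_le_mul_left _ hst) ?_ ?_ ?_ ?_
  · rw [← chi_nsmul, ← chi_nsmul, ← chi_add, ← chi_add]
    congr 1
    apply Subtype.ext
    push_cast
    rw [smul_sub, natCast_zsmul, natCast_zsmul, smul_smul, smul_smul, sub_eq_sub_iff_add_eq_add]
      at h
    rw [h, add_comm]
  · rw [facetTangent_chi, if_neg hc.2.1.ne', if_pos (FaceAssociated.refl c)]
  · rw [facetTangent_chi, if_neg hdv.ne', if_neg hnot]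
  · rw [facetTangent_chi, if_pos hb.2]

/-- Take `d` of least positive height. Irreducibles are associated to `d`, and induction on height
decomposes every element of `P` into irreducibles modulo `F`. -/
theorem IsSmoothPoint.isLocallyHalfSpace
    (hgen : AddSubgroup.closure (P : Set (Fin n → ℤ)) = ⊤) (hv : IsFacetNormal P v)
    (hsm : IsSmoothPoint (facetPoint (K := K) hv 1)) : IsLocallyHalfSpace P v := by
  classical
  have hex : ∃ k : ℕ, ∃ d ∈ P, d ⬝ᵥ v = k ∧ 0 < k := by
    obtain ⟨m, hm, hmv⟩ := hv.exists_pos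
    obtain ⟨k, hk⟩ := Int.eq_ofNat_of_zero_le hmv.le
    exact ⟨k, m, hm, hk, by omega⟩
  obtain ⟨d, hd, hdk, hk0⟩ := Nat.find_spec hex
  have hdv : 0 < d ⬝ᵥ v := by omega
  have hmin : ∀ m ∈ P, 0 < m ⬝ᵥ v → d ⬝ᵥ v ≤ m ⬝ᵥ v := by
    intro m hm hmv
    obtain ⟨l, hl⟩ := Int.eq_ofNat_of_zero_le hmv.le
    rw [hdk, hl]
    exact_mod_cast Nat.find_min' hex ⟨m, hm, hl, by omega⟩
  have key : ∀ (l : ℕ), ∀ m ∈ P, m ⬝ᵥ v ≤ l → ∃ j : ℕ, FaceAssociated P v m (j • d) := by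
    intro l
    induction l with
    | zero =>
      intro m hm hml
      have := hv.nonneg m hm
      exact ⟨0, 0, zero_mem _, m, ⟨hm, by push_cast at hml; omega⟩, by simp⟩
    | succ l ih =>
      intro m hm hml
      push_cast at hml
      rcases (hv.nonneg m hm).eq_or_lt with h0 | hpos
      · exact ih m hm (by omega)
      · by_cases hirr : IsFaceIrreducible P v m
        · exact ⟨1, by
            rw [one_smul]
            exact (IsSmoothPoint.faceAssociated hv hsm hirr hd hdv (hmin m hm hpos)).symm⟩
        · simp only [IsFaceIrreducible, not_and, not_forall, not_not] at hirr
          obtain ⟨a, ha, b, hb, hav, hbv, hab⟩ := hirr hm hpos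
          have heq := hab.dotProduct_eq
          rw [add_dotProduct] at heq
          obtain ⟨i, hi⟩ := ih a ha (by omega)
          obtain ⟨j, hj⟩ := ih b hb (by omega)
          exact ⟨i + j, hab.symm.trans (by rw [add_smul]; exact hi.add hj)⟩
  refine isLocallyHalfSpace_of_generator hgen hdv (zero_mem _) (by rwa [add_zero]) fun m hm => ?_
  obtain ⟨l, hl⟩ := Int.eq_ofNat_of_zero_le (hv.nonneg m hm)
  obtain ⟨j, a, ha, b, hb, h⟩ := key l m hm hl.le
  exact ⟨j, a, ha, b, hb, by rw [h, natCast_zsmul]⟩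

end

/-! ### The toric variety of a half-space -/

section

variable {K : Type*} [Field K] {n : ℕ} {P : AddSubmonoid (Fin n → ℤ)} {v : Fin n → ℤ}

/-- The monoid of lattice points of the half-space `v ≥ 0`. -/
def halfSpace {n : ℕ} (v : Fin n → ℤ) : AddSubmonoid (Fin n → ℤ) where
  carrier := {m | 0 ≤ m ⬝ᵥ v}
  zero_mem' := (zero_dotProduct v).ge
  add_mem' := fun {a b} ha hb => by
    change 0 ≤ (a + b) ⬝ᵥ v
    rw [add_dotProduct]
    exact add_nonneg ha hb

theorem mem_halfSpace {m : Fin n → ℤ} : m ∈ halfSpace v ↔ 0 ≤ m ⬝ᵥ v := Iff.rfl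

/-- The lattice `v^⊥`. -/
def boundaryLattice {n : ℕ} (v : Fin n → ℤ) : Submodule ℤ (Fin n → ℤ) :=
  LinearMap.ker ((dotProductBilin ℤ ℤ).flip v : (Fin n → ℤ) →ₗ[ℤ] ℤ)

theorem mem_boundaryLattice {m : Fin n → ℤ} : m ∈ boundaryLattice v ↔ m ⬝ᵥ v = 0 := Iff.rfl

/-- An element of `v^⊥` as an element of the half-space `v ≥ 0`. -/
def boundaryToHalfSpace (m : boundaryLattice v) : halfSpace v :=
  ⟨m, (mem_boundaryLattice.1 m.2).ge⟩

theorem chi_boundary_mul_neg (m : boundaryLattice v) :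
    chi K (halfSpace v) (boundaryToHalfSpace m) * chi K (halfSpace v) (boundaryToHalfSpace (-m)) =
      1 := by
  rw [← chi_add, ← chi_zero]
  congr 1
  exact Subtype.ext (add_neg_cancel (m : Fin n → ℤ))

/-- The characters of weights in `v^⊥` as units of the coordinate algebra of the half-space. -/
def boundaryUnit (K : Type*) [Field K] {n : ℕ} {v : Fin n → ℤ} (m : boundaryLattice v) :
    (coordRing K (halfSpace v))ˣ where
  val := chi K (halfSpace v) (boundaryToHalfSpace m)
  inv := chi K (halfSpace v) (boundaryToHalfSpace (-m))
  val_inv := chi_boundary_mul_neg m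
  inv_val := by rw [mul_comm, chi_boundary_mul_neg]

theorem boundaryUnit_add (a b : boundaryLattice v) :
    boundaryUnit K (a + b) = boundaryUnit K a * boundaryUnit K b :=
  Units.ext (chi_add (boundaryToHalfSpace a) (boundaryToHalfSpace b))

/-- The component of a lattice point in `v^⊥` with respect to a complementary vector `e`. -/
def boundaryPart {e : Fin n → ℤ} (he : e ⬝ᵥ v = 1) : (Fin n → ℤ) →+ boundaryLattice v :=
  AddMonoidHom.mk' (fun m => ⟨m - (m ⬝ᵥ v) • e, by
    rw [mem_boundaryLattice, sub_dotProduct, smul_dotProduct, he, smul_eq_mul, mul_one,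
      sub_self]⟩) fun a b => Subtype.ext (by
    change a + b - ((a + b) ⬝ᵥ v) • e = a - (a ⬝ᵥ v) • e + (b - (b ⬝ᵥ v) • e)
    rw [add_dotProduct, add_smul]
    abel)

/-- The half-space is `v^⊥ ⊕ ℕ e`. Units lift along a square-zero ideal and `v^⊥` is a projective
`ℤ`-module, so the characters of `v^⊥` lift compatibly, while `χ^e` may be lifted arbitrarily. -/
theorem formallySmooth_halfSpace (K : Type*) [Field K] {e : Fin n → ℤ} (he : e ⬝ᵥ v = 1) :
    Algebra.FormallySmooth K (coordRing K (halfSpace v)) := by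
  refine Algebra.FormallySmooth.of_comp_surjective fun B _ _ I hI f => ?_
  let heH : halfSpace v := ⟨e, by rw [mem_halfSpace, he]; exact zero_le_one⟩
  let u : boundaryLattice v →+ Additive (B ⧸ I)ˣ :=
    AddMonoidHom.mk' (fun m => Additive.ofMul (Units.map (f : _ →* B ⧸ I) (boundaryUnit K m)))
      fun a b => by rw [boundaryUnit_add, map_mul, ofMul_mul]
  let π : Additive Bˣ →+ Additive (B ⧸ I)ˣ :=
    MonoidHom.toAdditive (Units.map (Ideal.Quotient.mk I : B →* B ⧸ I))
  have hπ : Function.Surjective π.toIntLinearMap := by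
    intro z
    obtain ⟨b, hb⟩ := Ideal.Quotient.mk_surjective ((Additive.toMul z : (B ⧸ I)ˣ) : B ⧸ I)
    have hbu : IsUnit b := by
      rw [← IsNilpotent.isUnit_quotient_mk_iff ⟨2, hI⟩, hb]
      exact Units.isUnit _
    obtain ⟨w, rfl⟩ := hbu
    exact ⟨Additive.ofMul w, congrArg Additive.ofMul (Units.ext hb)⟩
  obtain ⟨U, hU⟩ := Module.projective_lifting_property π.toIntLinearMap u.toIntLinearMap hπ
  have hU' : ∀ m : boundaryLattice v,
      Ideal.Quotient.mk I ((Additive.toMul (U m) : Bˣ) : B) =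
        f (chi K (halfSpace v) (boundaryToHalfSpace m)) := by
    intro m
    have := congrArg (fun z : Additive (B ⧸ I)ˣ => ((Additive.toMul z : (B ⧸ I)ˣ) : B ⧸ I))
      (LinearMap.congr_fun hU m)
    exact this
  obtain ⟨β, hβ⟩ := Ideal.Quotient.mk_surjective (f (chi K (halfSpace v) heH))
  let F : Multiplicative (halfSpace v) →* B :=
    { toFun := fun m => β ^ ((m.toAdd : Fin n → ℤ) ⬝ᵥ v).toNat *
        ((Additive.toMul (U (boundaryPart he (m.toAdd : Fin n → ℤ))) : Bˣ) : B)
      map_one' := by simp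
      map_mul' := fun a b => by
        rw [toAdd_mul, AddSubmonoid.coe_add, add_dotProduct, Int.toNat_add a.toAdd.2 b.toAdd.2,
          pow_add, map_add, map_add, toMul_add, Units.val_mul]
        ring }
  refine ⟨coordLift F, coordRing_algHom_ext fun m => ?_⟩
  rw [AlgHom.comp_apply, coordLift_chi, Ideal.Quotient.mkₐ_eq_mk]
  change Ideal.Quotient.mk I (β ^ ((m : Fin n → ℤ) ⬝ᵥ v).toNat *
    ((Additive.toMul (U (boundaryPart he (m : Fin n → ℤ))) : Bˣ) : B)) = _
  rw [map_mul, map_pow, hβ, hU', ← map_pow, ← map_mul, ← chi_nsmul, ← chi_add]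
  congr 2
  apply Subtype.ext
  obtain ⟨k, hk⟩ := Int.eq_ofNat_of_zero_le (mem_halfSpace.1 m.2)
  change ((m : Fin n → ℤ) ⬝ᵥ v).toNat • e + ((m : Fin n → ℤ) - ((m : Fin n → ℤ) ⬝ᵥ v) • e) = m
  rw [hk, Int.toNat_natCast, natCast_zsmul, add_sub_cancel]

/-! ### Localization at a facet -/

/-- The multiplicative set of the characters `χ^q` with `q ∈ P ∩ v^⊥`. -/
def faceCharacters (K : Type*) [Field K] {n : ℕ} (P : AddSubmonoid (Fin n → ℤ))
    (v : Fin n → ℤ) : Submonoid (coordRing K P) where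
  carrier := {f | ∃ q : P, (q : Fin n → ℤ) ⬝ᵥ v = 0 ∧ f = chi K P q}
  one_mem' := ⟨0, zero_dotProduct v, chi_zero.symm⟩
  mul_mem' := by
    rintro _ _ ⟨a, ha, rfl⟩ ⟨b, hb, rfl⟩
    exact ⟨a + b, by rw [AddSubmonoid.coe_add, add_dotProduct, ha, hb, add_zero],
      (chi_add a b).symm⟩

theorem coordRing_mono (K : Type*) [Field K] {Q : AddSubmonoid (Fin n → ℤ)} (h : P ≤ Q) :
    coordRing K P ≤ coordRing K Q := fun _ hf =>
  mem_coordRing.2 fun m hm => mem_coordRing.1 hf m fun hmP => hm (h hmP)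

/-- The half-space contains `-q` for `q ∈ F`, so face characters become units; `IsLocallyHalfSpace`
says precisely that they suffice as denominators. -/
theorem IsLocallyHalfSpace.isLocalization (hloc : IsLocallyHalfSpace P v)
    (hP : P ≤ halfSpace v) :
    letI := (Subalgebra.inclusion (coordRing_mono K hP)).toAlgebra
    IsLocalization (faceCharacters K P v) (coordRing K (halfSpace v)) := by
  let _ := (Subalgebra.inclusion (coordRing_mono K hP)).toAlgebra
  have hmap : ∀ f : coordRing K P, algebraMap (coordRing K P) (coordRing K (halfSpace v)) f =
      Subalgebra.inclusion (coordRing_mono K hP) f := fun _ => rfl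
  have hchi : ∀ m : P, Subalgebra.inclusion (coordRing_mono K hP) (chi K P m) =
      chi K (halfSpace v) ⟨m, hP m.2⟩ := fun _ => rfl
  refine ⟨?_, ?_, ?_⟩
  · rintro ⟨_, q, hq, rfl⟩
    exact (boundaryUnit K (⟨q, hq⟩ : boundaryLattice v)).isUnit
  · intro z
    simp only [hmap]
    refine coordRing_induction (p := fun z => ∃ x : coordRing K P × faceCharacters K P v,
      z * Subalgebra.inclusion (coordRing_mono K hP) x.2 =
        Subalgebra.inclusion (coordRing_mono K hP) x.1) z ⟨(0, 1), by simp⟩ ?_ ?_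
    · rintro z w ⟨⟨x, s⟩, hx⟩ ⟨⟨y, t⟩, hy⟩
      refine ⟨(x * t + y * s, s * t), ?_⟩
      simp only [Submonoid.coe_mul, map_mul, map_add] at hx hy ⊢
      rw [← hx, ← hy]
      ring
    · intro c m
      obtain ⟨q, hq, hmq⟩ := hloc m m.2
      refine ⟨(c • chi K P ⟨m + q, hmq⟩, ⟨chi K P ⟨q, hq.1⟩, ⟨q, hq.1⟩, hq.2, rfl⟩), ?_⟩
      simp only [map_smul, hchi]
      rw [smul_mul_assoc, ← chi_add]
      rfl
  · intro x y hxy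
    exact ⟨1, by rw [Subalgebra.inclusion_injective (coordRing_mono K hP) hxy]⟩

theorem formallySmooth_localization_of_le {R A A' L : Type*} [CommRing R] [CommRing A]
    [CommRing A'] [CommRing L] [Algebra R A] [Algebra R A'] [Algebra R L] [Algebra A A']
    [Algebra A L] [IsScalarTower R A A'] [IsScalarTower R A L] [Algebra.FormallySmooth R A']
    (M N : Submonoid A) (hMN : M ≤ N) [IsLocalization M A'] [IsLocalization N L] :
    Algebra.FormallySmooth R L := by
  let φ : A' →ₐ[A] L := IsLocalization.liftAlgHom (M := M) (f := Algebra.ofId A L)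
    fun y => IsLocalization.map_units L (⟨y, hMN y.2⟩ : N)
  let _ := φ.toAlgebra
  have : IsScalarTower A A' L := IsScalarTower.of_algebraMap_eq' φ.comp_algebraMap.symm
  have : IsScalarTower R A' L := by
    refine IsScalarTower.of_algebraMap_eq fun r => ?_
    rw [IsScalarTower.algebraMap_apply R A A', ← IsScalarTower.algebraMap_apply A A' L,
      ← IsScalarTower.algebraMap_apply R A L]
  have : IsLocalization (N.map (algebraMap A A')) L :=
    IsLocalization.isLocalization_of_submonoid_le A' L M N hMN
  have : Algebra.FormallySmooth A' L :=
    Algebra.FormallySmooth.of_isLocalization (N.map (algebraMap A A'))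
  exact Algebra.FormallySmooth.comp R A' L

/-- Face characters do not vanish at `x`, so the local ring at `x` is a further localization of the
algebra of the half-space. -/
theorem IsLocallyHalfSpace.isSmoothPoint (hloc : IsLocallyHalfSpace P v)
    (hv : IsFacetNormal P v) (hprim : ∀ (k : ℤ) (u : Fin n → ℤ), v = k • u → IsUnit k)
    {x : Point K P} (hx : ∀ q : P, (q : Fin n → ℤ) ⬝ᵥ v = 0 → x (chi K P q) ≠ 0) :
    IsSmoothPoint x := by
  obtain ⟨e, he⟩ := exists_dotProduct_eq_neg_one hprim
  have := formallySmooth_halfSpace K (e := -e) (v := v) (by rw [neg_dotProduct, he, neg_neg])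
  have hP : P ≤ halfSpace v := hv.nonneg
  have hker : (RingHom.ker x).IsPrime := RingHom.ker_isPrime x
  let _ := (Subalgebra.inclusion (coordRing_mono K hP)).toAlgebra
  have := hloc.isLocalization (K := K) hP
  have : IsScalarTower K (coordRing K P) (coordRing K (halfSpace v)) :=
    IsScalarTower.of_algebraMap_eq' (Subalgebra.inclusion (coordRing_mono K hP)).comp_algebraMap.symm
  refine formallySmooth_localization_of_le (A' := coordRing K (halfSpace v))
    (L := Localization.AtPrime (RingHom.ker x)) (faceCharacters K P v)
    (RingHom.ker x).primeCompl ?_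
  rintro _ ⟨q, hq, rfl⟩
  exact hx q hq

theorem forall_isSmoothPoint_iff [IsAlgClosed K] [CharZero K] (hfg : P.FG)
    (hgen : AddSubgroup.closure (P : Set (Fin n → ℤ)) = ⊤) (hv : IsFacetNormal P v)
    (hprim : ∀ (k : ℤ) (u : Fin n → ℤ), v = k • u → IsUnit k) {τ : PointedCone ℚ (Fin n → ℚ)}
    (hτ : ∀ m ∈ P, latticeVec m ∈ τ ↔ m ⬝ᵥ v = 0) :
    (∀ x ∈ faceOrbit K P τ, IsSmoothPoint x) ↔ IsLocallyHalfSpace P v :=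
  ⟨fun h => IsSmoothPoint.isLocallyHalfSpace hgen hv
      (h _ (facetPoint_one_mem_faceOrbit hfg hv hτ)),
    fun h _ hx => h.isSmoothPoint hv hprim fun _ hq =>
      apply_chi_ne_zero_of_mem_faceOrbit hv hτ hx hq⟩

end

end

end ToricLND

theorem mainTheorem9 {K : Type*} [Field K] [IsAlgClosed K] [CharZero K] {n : ℕ}
    (P : AddSubmonoid (Fin n → ℤ)) (hfg : P.FG)
    (hgen : AddSubgroup.closure (P : Set (Fin n → ℤ)) = ⊤)
    (ρ : PointedCone ℚ (Fin n → ℚ)) (hρ : ToricLND.IsExtremalRay ρ (ToricLND.fanCone P))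
    (nρ : Fin n → ℤ) (hnρ : ToricLND.IsPrimitiveVectorOn ρ nρ) :
    List.TFAE
      [ToricLND.IsAlmostSaturated P (ToricLND.dualFace P ρ),
        ∃ e ∈ ToricLND.demazureRoots P ρ, ToricLND.DemazureLNDWellDefined K P nρ e,
        ∀ x ∈ ToricLND.faceOrbit K P (ToricLND.dualFace P ρ), ToricLND.IsSmoothPoint x] := by
  have hv := hρ.isFacetNormal hfg hgen hnρ.1 hnρ.2.1
  rw [ToricLND.isAlmostSaturated_iff_isLocallyHalfSpace hfg hρ hnρ.1 hnρ.2.1 hv,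
    ToricLND.exists_demazureRoot_iff K hfg hgen hρ hnρ hv,
    ToricLND.forall_isSmoothPoint_iff hfg hgen hv hnρ.2.2
      fun m hm => ToricLND.latticeVec_mem_dualFace_iff hρ hnρ.1 hnρ.2.1 hm]
  simp
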